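/- Let $m_1,m_2,r_1,r_2,g>0$. Consider the planar inverted double pendulum on a cart, with state $z=(\theta_1,\theta_2,\omega_1,\omega_2)$ in the state space $M=S^1\times S^1\times\mathbb R^2$ (angles $\theta_i$ taken modulo $2\pi$), governed by the control system $\dot z=f(z)+h(z)u$, $u\in\mathbb R$, where, with $\Delta=r_1r_2[m_1+m_2\sin^2(\theta_1-\theta_2)]$, $$f(z)=\frac1\Delta\begin{pmatrix}\omega_1\Delta\\ \omega_2\Delta\\ -g r_2[m_2\sin\theta_2\cos(\theta_1-\theta_2)-(m_1+m_2)\sin\theta_1]\\ -g r_1(m_1+m_2)[\cos(\theta_1-\theta_2)\sin\theta_1-\sin\theta_2]\end{pmatrix}+\frac{\sin(\theta_1-\theta_2)}{\Delta}\begin{pmatrix}0\\0\\-m_2r_2[r_1\cos(\theta_1-\theta_2)\omega_1^2+r_2\omega_2^2]\\ r_1[r_1(m_1+m_2)\omega_1^2+r_2m_2\cos(\theta_1-\theta_2)\omega_2^2]\end{pmatrix},$$ $$h(z)=\frac{m_2}{\Delta}\begin{pmatrix}0\\0\\ r_2[r_1m_2\cos(\theta_1-\theta_2)-r_2m_1]\\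 r_1[r_2m_1\cos(\theta_1-\theta_2)-r_1(m_1+m_2)]\end{pmatrix}.$$ Assume that $$\frac{m_1}{m_2}\ne\frac{r_1(r_1\pm r_2)}{r_2^2-r_1(r_1\pm r_2)}\ \text{(for both choices of sign)}\qquad\text{and}\qquad \frac{m_1}{m_2}\ne\frac{r_2^2-r_1^2}{r_1^2}$$ (a condition whose denominator vanishes is regarded as satisfied). Let $X_1=\Delta f$, $X_2=\Delta h$, $X_3=[X_1,X_2]$, $X_4=[X_2,X_3]$, where $[V,W]=DW\,V-DV\,W$, and assume that the family $F=\{X_1,X_2,X_3,X_4\}$ is bracket-generating, i.e. at every point $p\in M$ the values at $p$ of the vector fields in the linear span of all iterated Lie brackets of members of $F$ (the members themselves included) fill $T_pM$. Then the control system $\dot z=f(z)+h(z)u$ is controllable: for every $p\in M$, the attainable set from $p$, that is, the set of all points reached from $p$ by finitely many successive forward-in-time motions along vector fields $f+uh$ with constant $u\in\mathbb R$ (i.e. by piecewise constant controls), is all of $M$. -/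

import Mathlib

noncomputable section

/-! ### Families of vector fields on `ℝⁿ`: Lie algebra and bracket generation -/

section Families

variable {E : Type*} [NormedAddCommGroup E] [NormedSpace ℝ E]

/-- The iterated Lie brackets `[X₁, [X₂, … [Xₖ₋₁, Xₖ] … ]]`, `k ≥ 1`, of members of the family `F`.
The bracket is `[V, W] (x) = DW(x) V(x) - DV(x) W(x)`. -/
inductive IteratedBracket (F : Set (E → E)) : (E → E) → Prop
  | of {X : E → E} (hX : X ∈ F) : IteratedBracket F X
  | bracket {X Y : E → E} (hX : X ∈ F) (hY : IteratedBracket F Y) :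
      IteratedBracket F (VectorField.lieBracket ℝ X Y)

/-- `Lie(F)`: the real linear span of all iterated Lie brackets of members of `F`. -/
def LieSpan (F : Set (E → E)) : Submodule ℝ (E → E) :=
  Submodule.span ℝ {X | IteratedBracket F X}

/-- `Lie_p(F)`: the values at `p` of the vector fields in `Lie(F)`. -/
def LieSpanAt (F : Set (E → E)) (p : E) : Submodule ℝ E :=
  (LieSpan F).map (LinearMap.proj p : (E → E) →ₗ[ℝ] E)

/-- `F` is bracket-generating: `Lie_p(F)` is the whole tangent space at every point `p`. -/
def BracketGenerating (F : Set (E → E)) : Prop :=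
  ∀ p : E, LieSpanAt F p = ⊤

end Families

/-! ### The planar inverted double pendulum on a cart -/

namespace Pendulum

/-- Masses, lengths of the two beams, and gravitational acceleration. -/
structure Params where
  m₁ : ℝ
  m₂ : ℝ
  r₁ : ℝ
  r₂ : ℝ
  g : ℝ

/-- Coordinates `z = (θ₁, θ₂, ω₁, ω₂)`, the angles being represented by real numbers. -/
abbrev Coord : Type := Fin 4 → ℝ

/-- The state space `S¹ × S¹ × ℝ × ℝ`: two angles (modulo `2π`) and two angular velocities. -/
abbrev State : Type := Real.Angle × Real.Angle × ℝ × ℝ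

/-- The state with coordinates `z`; this is the universal covering map `ℝ⁴ → S¹ × S¹ × ℝ²`. -/
def toState (z : Coord) : State := ((z 0 : Real.Angle), (z 1 : Real.Angle), z 2, z 3)

/-- `Δ(θ) = r₁ r₂ (m₁ + m₂ sin² (θ₁ - θ₂))`. -/
def Δ (P : Params) (z : Coord) : ℝ :=
  P.r₁ * P.r₂ * (P.m₁ + P.m₂ * Real.sin (z 0 - z 1) ^ 2)

/-- The drift `f` of the system `ż = f(z) + h(z) u`. -/
def f (P : Params) (z : Coord) : Coord :=
  (1 / Δ P z) •
    ![z 2 * Δ P z,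
      z 3 * Δ P z,
      -P.g * P.r₂ * (P.m₂ * Real.sin (z 1) * Real.cos (z 0 - z 1)
        - (P.m₁ + P.m₂) * Real.sin (z 0)),
      -P.g * P.r₁ * (P.m₁ + P.m₂) * (Real.cos (z 0 - z 1) * Real.sin (z 0) - Real.sin (z 1))]
  + (Real.sin (z 0 - z 1) / Δ P z) •
    ![0,
      0,
      -P.m₂ * P.r₂ * (P.r₁ * Real.cos (z 0 - z 1) * z 2 ^ 2 + P.r₂ * z 3 ^ 2),
      P.r₁ * (P.r₁ * (P.m₁ + P.m₂) * z 2 ^ 2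
        + P.r₂ * P.m₂ * Real.cos (z 0 - z 1) * z 3 ^ 2)]

/-- The control vector field `h` of the system `ż = f(z) + h(z) u`. -/
def h (P : Params) (z : Coord) : Coord :=
  (P.m₂ / Δ P z) •
    ![0,
      0,
      P.r₂ * (P.r₁ * P.m₂ * Real.cos (z 0 - z 1) - P.r₂ * P.m₁),
      P.r₁ * (P.r₂ * P.m₁ * Real.cos (z 0 - z 1) - P.r₁ * (P.m₁ + P.m₂))]

/-- `X₁ = Δ f`. -/
def X₁ (P : Params) : Coord → Coord := fun z => Δ P z • f P z

/-- `X₂ = Δ h`. -/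
def X₂ (P : Params) : Coord → Coord := fun z => Δ P z • h P z

/-- `X₃ = [X₁, X₂]`. -/
def X₃ (P : Params) : Coord → Coord := VectorField.lieBracket ℝ (X₁ P) (X₂ P)

/-- `X₄ = [X₂, X₃]`. -/
def X₄ (P : Params) : Coord → Coord := VectorField.lieBracket ℝ (X₂ P) (X₃ P)

/-- The family `{X₁, X₂, X₃, X₄}`. -/
def family (P : Params) : Set (Coord → Coord) := {X₁ P, X₂ P, X₃ P, X₄ P}

/-- The vector fields `f + u h` of the control system, one for each constant control value `u`. -/
def systemFields (P : Params) : Set (Coord → Coord) :=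
  {X | ∃ u : ℝ, X = fun z => f P z + u • h P z}

/-- `f` depends only on the state: it descends to a vector field on `State`. -/
theorem f_congr (P : Params) {z w : Coord} (hzw : toState z = toState w) : f P z = f P w := by
  simp only [toState, Prod.mk.injEq] at hzw
  obtain ⟨h0, h1, h2, h3⟩ := hzw
  have hs0 : Real.sin (z 0) = Real.sin (w 0) := by
    rw [← Real.Angle.sin_coe, h0, Real.Angle.sin_coe]
  have hs1 : Real.sin (z 1) = Real.sin (w 1) := by
    rw [← Real.Angle.sin_coe, h1, Real.Angle.sin_coe]
  have hs : Real.sin (z 0 - z 1) = Real.sin (w 0 - w 1) := by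
    rw [← Real.Angle.sin_coe, Real.Angle.coe_sub, h0, h1, ← Real.Angle.coe_sub,
      Real.Angle.sin_coe]
  have hc : Real.cos (z 0 - z 1) = Real.cos (w 0 - w 1) := by
    rw [← Real.Angle.cos_coe, Real.Angle.coe_sub, h0, h1, ← Real.Angle.coe_sub,
      Real.Angle.cos_coe]
  simp only [f, Δ, hs0, hs1, hs, hc, h2, h3]

/-- `h` depends only on the state: it descends to a vector field on `State`. -/
theorem h_congr (P : Params) {z w : Coord} (hzw : toState z = toState w) : h P z = h P w := by
  simp only [toState, Prod.mk.injEq] at hzw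
  obtain ⟨h0, h1, -, -⟩ := hzw
  have hs : Real.sin (z 0 - z 1) = Real.sin (w 0 - w 1) := by
    rw [← Real.Angle.sin_coe, Real.Angle.coe_sub, h0, h1, ← Real.Angle.coe_sub,
      Real.Angle.sin_coe]
  have hc : Real.cos (z 0 - z 1) = Real.cos (w 0 - w 1) := by
    rw [← Real.Angle.cos_coe, Real.Angle.coe_sub, h0, h1, ← Real.Angle.coe_sub,
      Real.Angle.cos_coe]
  simp only [h, Δ, hs, hc]

/-- `q` is reached from `p` by following the flow of some `X ∈ F` forward for a time `t ≥ 0`.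
Integral curves on `State` are the images under `toState` of integral curves in coordinates. -/
def Step (F : Set (Coord → Coord)) (p q : State) : Prop :=
  ∃ X ∈ F, ∃ t : ℝ, 0 ≤ t ∧ ∃ γ : ℝ → Coord,
    IsIntegralCurveOn γ (fun _ => X) (Set.Icc 0 t) ∧ toState (γ 0) = p ∧ toState (γ t) = q

/-- The attainable set `A_p(F)`: all states reached from `p` by finitely many successive forward
motions along members of `F`. -/
def attainableSet (F : Set (Coord → Coord)) (p : State) : Set State :=
  {q | Relation.ReflTransGen (Step F) p q}

/-- The control system `ż = f(z) + h(z) u` is controllable: the attainable set from every state,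
by means of piecewise constant real controls `u`, is the whole state space. -/
def Controllable (P : Params) : Prop :=
  ∀ p : State, attainableSet (systemFields P) p = Set.univ

end Pendulum

end

open Set Filter Topology Metric
open scoped ContDiff NNReal

/-!
The pendulum is controllable because its uncontrolled motion is conservative, hence recurrent, while
the bracket condition gives every attainable set an interior.

*Rescaling.* Let `E` be the energy of the uncontrolled double pendulum, normalized to be positive.
Multiplying `f + u h` by the positive function `Δ / E` changes only the time parameter of trajectories
(`exists_integralCurveOn_of_smul`), and turns the system into `drift + u control` with
`drift = X₁ / E` and `control = X₂ / E`. These fields are bounded, so their flows are globally defined,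
and are `C¹` by the variational equation (`BoundedSmooth.hasStrictFDerivAt_flow`). The module over
the smooth functions generated by their brackets (`InLieModule`) contains `X₁, …, X₄`, so the
bracket-generating hypothesis says that it fills every tangent space.

*Krener's theorem* (`interior_nonempty_of_flow_invariant`). A nonempty set invariant under the forward
flows of such a family of fields has an interior point. Among the tangent spaces `V` of families of
points of the set choose one, at a point `q`, of maximal dimension. It can be transported by the
flows but cannot be enlarged, so the fields of the family lie in all transported spaces, and
differentiating this along the flows shows that brackets lie in them too. So `V` is everything, and
the inverse function theorem applies.

*Recurrence* (`BoundedSmooth.subset_closure_image_flow`). The field `X₁` is divergence-free and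
preserves `E`, so `drift` is divergence-free and its flow preserves the volume of `ℝ⁴`. The sublevel
sets of `E` have finite volume modulo the periods of the angles. Hence an open periodic set which is
mapped into itself by this flow is mapped onto a dense subset of itself.

*Conclusion* (`reachable_of_recurrent_drift`). Let `S` be the closure of the interior of the attainable
set of a point, viewed in `ℝ⁴`. It is invariant under the flows of `drift + u control` forward in
time; under `± control`, by letting `u → ± ∞`; and under `drift` backward in time, by recurrence. Its
frontier is then invariant under the flows of `drift` and `control`, and has empty interior, so
Krener's theorem forces it to be empty, and `S` is everything. So attainable sets contain dense open
sets. By Krener's theorem for the reversed fields, the set of points from which a given target is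
reachable has an interior point, hence meets the attainable set.
-/

/-! ### Flows of bounded smooth vector fields -/

section Flow

variable {E : Type*} [NormedAddCommGroup E] [NormedSpace ℝ E]

/-- A smooth vector field with bounded values (its derivatives may be unbounded). Boundedness keeps
every trajectory in a ball whose radius is linear in time, so that such a field is complete. -/
structure BoundedSmooth (X : E → E) : Prop where
  contDiff : ContDiff ℝ ∞ X
  bounded : ∃ M : ℝ, 0 ≤ M ∧ ∀ x, ‖X x‖ ≤ M

lemma BoundedSmooth.neg {X : E → E} (hX : BoundedSmooth X) : BoundedSmooth (-X) := by
  obtain ⟨M, hM, hb⟩ := hX.bounded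
  exact ⟨hX.contDiff.neg, M, hM, fun x => by simpa using hb x⟩

lemma BoundedSmooth.const_smul {X : E → E} (hX : BoundedSmooth X) (c : ℝ) :
    BoundedSmooth (c • X) := by
  obtain ⟨M, hM, hb⟩ := hX.bounded
  refine ⟨hX.contDiff.const_smul c, |c| * M, by positivity, fun x => ?_⟩
  rw [Pi.smul_apply, norm_smul, Real.norm_eq_abs]
  gcongr
  exact hb x

lemma BoundedSmooth.add {X Y : E → E} (hX : BoundedSmooth X) (hY : BoundedSmooth Y) :
    BoundedSmooth (X + Y) := by
  obtain ⟨M, hM, hb⟩ := hX.bounded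
  obtain ⟨N, hN, hc⟩ := hY.bounded
  exact ⟨hX.contDiff.add hY.contDiff, M + N, by positivity,
    fun x => (norm_add_le _ _).trans (add_le_add (hb x) (hc x))⟩

lemma norm_sub_le_of_hasDerivAt_bounded {X : E → E} {M : ℝ} (hM : ∀ x, ‖X x‖ ≤ M) {γ : ℝ → E}
    {s : Set ℝ} (hs : Convex ℝ s) (hγ : ∀ t ∈ s, HasDerivAt γ (X (γ t)) t) {t t' : ℝ}
    (ht : t ∈ s) (ht' : t' ∈ s) : ‖γ t' - γ t‖ ≤ M * |t' - t| :=
  hs.norm_image_sub_le_of_norm_hasDerivWithin_le (fun x hx => (hγ x hx).hasDerivWithinAt)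
    (fun _ _ => hM _) ht ht'

variable [FiniteDimensional ℝ E]

lemma exists_lipschitzOnWith_closedBall {F : Type*} [NormedAddCommGroup F] [NormedSpace ℝ F]
    {X : E → F} (hX : ContDiff ℝ 1 X) (x : E) (r : ℝ) :
    ∃ K : ℝ≥0, LipschitzOnWith K X (closedBall x r) := by
  have : ProperSpace E := FiniteDimensional.proper ℝ E
  exact hX.locallyLipschitz.locallyLipschitzOn.exists_lipschitzOnWith_of_compact
    (isCompact_closedBall x r)

lemma BoundedSmooth.eqOn_Ioo {X : E → E} (hX : BoundedSmooth X) {γ η : ℝ → E} {a b t₀ : ℝ}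
    (ht₀ : t₀ ∈ Ioo a b) (hγ : ∀ t ∈ Ioo a b, HasDerivAt γ (X (γ t)) t)
    (hη : ∀ t ∈ Ioo a b, HasDerivAt η (X (η t)) t) (h : γ t₀ = η t₀) : EqOn γ η (Ioo a b) := by
  obtain ⟨M, hM, hb⟩ := hX.bounded
  obtain ⟨K, hK⟩ := exists_lipschitzOnWith_closedBall (hX.contDiff.of_le (by simp)) (γ t₀)
    (M * (b - a))
  have key : ∀ ζ : ℝ → E, (∀ t ∈ Ioo a b, HasDerivAt ζ (X (ζ t)) t) → ζ t₀ = γ t₀ →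
      ∀ t ∈ Ioo a b, ζ t ∈ closedBall (γ t₀) (M * (b - a)) := by
    intro ζ hζ h0 t ht
    rw [mem_closedBall, dist_eq_norm, ← h0]
    refine (norm_sub_le_of_hasDerivAt_bounded hb (convex_Ioo a b) hζ ht₀ ht).trans ?_
    gcongr
    rw [abs_le]
    constructor <;> linarith [ht.1, ht.2, ht₀.1, ht₀.2]
  exact ODE_solution_unique_of_mem_Ioo (v := fun _ => X) (s := fun _ => _) (fun _ _ => hK) ht₀
    (fun t ht => ⟨hγ t ht, key γ hγ rfl t ht⟩) (fun t ht => ⟨hη t ht, key η hη h.symm t ht⟩) h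

lemma BoundedSmooth.exists_integralCurve {X : E → E} (hX : BoundedSmooth X) (x : E) :
    ∃ γ : ℝ → E, γ 0 = x ∧ ∀ t, HasDerivAt γ (X (γ t)) t := by
  obtain ⟨M, hM, hb⟩ := hX.bounded
  have : CompleteSpace E := FiniteDimensional.complete ℝ E
  -- On a ball of radius `M * T` the Picard–Lindelöf theorem reaches all times in `[-T, T]`.
  have loc : ∀ T : ℝ, 0 < T → ∃ γ : ℝ → E, γ 0 = x ∧ ∀ t ∈ Ioo (-T) T,
      HasDerivAt γ (X (γ t)) t := by
    intro T hT
    obtain ⟨K, hK⟩ := exists_lipschitzOnWith_closedBall (hX.contDiff.of_le (by simp)) x (M * T)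
    have hpl : IsPicardLindelof (fun _ => X) (tmin := -T) (tmax := T)
        ⟨0, by constructor <;> linarith⟩ x ⟨M * T, by positivity⟩ 0 ⟨M, hM⟩ K := by
      refine .of_time_independent (fun y _ => hb y) hK ?_
      change M * max (T - 0) (0 - -T) ≤ M * T - 0
      simp
    obtain ⟨γ, h0, h1⟩ := hpl.exists_eq_forall_mem_Icc_hasDerivWithinAt₀
    exact ⟨γ, h0, fun t ht => (h1 t (Ioo_subset_Icc_self ht)).hasDerivAt (Icc_mem_nhds ht.1 ht.2)⟩
  choose! γ h0 h1 using loc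
  have agree : ∀ S T : ℝ, 0 < S → S ≤ T → EqOn (γ S) (γ T) (Ioo (-S) S) := fun S T hS hST =>
    hX.eqOn_Ioo (t₀ := 0) (by simpa using hS) (h1 S hS)
      (fun t ht => h1 T (by linarith) t ⟨by linarith [ht.1], by linarith [ht.2]⟩)
      ((h0 S hS).trans (h0 T (by linarith)).symm)
  refine ⟨fun t => γ (|t| + 1) t, h0 _ (by positivity), fun t => ?_⟩
  have hev : (fun s => γ (|s| + 1) s) =ᶠ[𝓝 t] γ (|t| + 2) := by
    have hn : ∀ᶠ s in 𝓝 t, |s| < |t| + 1 :=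
      continuous_abs.continuousAt.eventually_lt continuousAt_const (by linarith)
    filter_upwards [hn] with s hs
    exact agree _ _ (by positivity) (by linarith)
      ⟨by linarith [neg_abs_le s], by linarith [le_abs_self s]⟩
  have hd := h1 (|t| + 2) (by positivity) t
    ⟨by linarith [neg_abs_le t], by linarith [le_abs_self t]⟩
  have := hd.congr_of_eventuallyEq hev
  rwa [← hev.eq_of_nhds] at this

open Classical in
/-- The flow of `X`: `flow X t x` is the value at time `t` of the integral curve of `X` which starts
at `x`. It is the identity if no global integral curve exists. -/
noncomputable def flow (X : E → E) (t : ℝ) (x : E) : E :=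
  if h : ∃ γ : ℝ → E, γ 0 = x ∧ ∀ t, HasDerivAt γ (X (γ t)) t then h.choose t else x

variable {X : E → E}

namespace BoundedSmooth

lemma flow_zero (hX : BoundedSmooth X) (x : E) : flow X 0 x = x := by
  have h := hX.exists_integralCurve x
  rw [flow, dif_pos h]
  exact h.choose_spec.1

lemma hasDerivAt_flow (hX : BoundedSmooth X) (t : ℝ) (x : E) :
    HasDerivAt (fun t => flow X t x) (X (flow X t x)) t := by
  have h := hX.exists_integralCurve x
  simp only [flow, dif_pos h]
  exact h.choose_spec.2 t

lemma eq_flow (hX : BoundedSmooth X) {γ : ℝ → E} (hγ : ∀ t, HasDerivAt γ (X (γ t)) t) (t : ℝ) :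
    γ t = flow X t (γ 0) := by
  refine hX.eqOn_Ioo (a := -(|t| + 1)) (b := |t| + 1) (t₀ := 0)
    ⟨by linarith [abs_nonneg t], by positivity⟩ (fun s _ => hγ s)
    (fun s _ => hX.hasDerivAt_flow s _) (hX.flow_zero _).symm
    ⟨by linarith [neg_abs_le t], by linarith [le_abs_self t]⟩

lemma flow_add (hX : BoundedSmooth X) (s t : ℝ) (x : E) :
    flow X (s + t) x = flow X s (flow X t x) := by
  have := hX.eq_flow (γ := fun s => flow X (s + t) x)
    (fun s => (hX.hasDerivAt_flow (s + t) x).comp_add_const s t) s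
  simpa using this

lemma flow_neg_flow (hX : BoundedSmooth X) (t : ℝ) (x : E) : flow X (-t) (flow X t x) = x := by
  rw [← hX.flow_add, neg_add_cancel, hX.flow_zero]

lemma flow_flow_neg (hX : BoundedSmooth X) (t : ℝ) (x : E) : flow X t (flow X (-t) x) = x := by
  rw [← hX.flow_add, add_neg_cancel, hX.flow_zero]

lemma flow_const_smul (hX : BoundedSmooth X) (c t : ℝ) (x : E) :
    flow (c • X) t x = flow X (c * t) x := by
  have := (hX.const_smul c).eq_flow (γ := fun t => flow X (c * t) x) (fun t => by
    have h : HasDerivAt (fun t => flow X (c * t) x) _ t :=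
      (hX.hasDerivAt_flow (c * t) x).scomp t ((hasDerivAt_id t).const_mul c)
    simpa using h) t
  simpa [hX.flow_zero] using this.symm

lemma flow_neg (hX : BoundedSmooth X) (t : ℝ) (x : E) : flow (-X) t x = flow X (-t) x := by
  simpa using hX.flow_const_smul (-1) t x

lemma norm_flow_sub_flow_le (hX : BoundedSmooth X) {M : ℝ} (hM : ∀ x, ‖X x‖ ≤ M) (s t : ℝ) (x : E) :
    ‖flow X t x - flow X s x‖ ≤ M * |t - s| :=
  norm_sub_le_of_hasDerivAt_bounded hM convex_univ (fun t _ => hX.hasDerivAt_flow t x)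
    (mem_univ s) (mem_univ t)

lemma norm_flow_sub_le (hX : BoundedSmooth X) {M : ℝ} (hM : ∀ x, ‖X x‖ ≤ M) (t : ℝ) (x : E) :
    ‖flow X t x - x‖ ≤ M * |t| := by
  simpa [hX.flow_zero] using hX.norm_flow_sub_flow_le hM 0 t x

lemma continuous_flow_left (hX : BoundedSmooth X) (x : E) : Continuous fun t => flow X t x :=
  continuous_iff_continuousAt.2 fun t => (hX.hasDerivAt_flow t x).continuousAt

lemma flow_mem_closedBall (hX : BoundedSmooth X) {M : ℝ} (hM0 : 0 ≤ M) (hM : ∀ x, ‖X x‖ ≤ M)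
    {t T r : ℝ} {x x₀ : E} (ht : |t| ≤ T) (hx : x ∈ closedBall x₀ r) :
    flow X t x ∈ closedBall x₀ (r + M * T) := by
  rw [mem_closedBall, dist_eq_norm] at hx ⊢
  have h1 := hX.norm_flow_sub_le hM t x
  have h2 : M * |t| ≤ M * T := by gcongr
  calc ‖flow X t x - x₀‖ = ‖(flow X t x - x) + (x - x₀)‖ := by abel_nf
    _ ≤ ‖flow X t x - x‖ + ‖x - x₀‖ := norm_add_le _ _
    _ ≤ _ := by linarith

/-- On bounded sets and bounded time intervals the flow is Lipschitz in the initial point. -/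
lemma exists_lipschitz_flow (hX : BoundedSmooth X) (x₀ : E) (r T : ℝ) :
    ∃ L : ℝ≥0, ∀ t ∈ Icc (-T) T, LipschitzOnWith L (flow X t) (closedBall x₀ r) := by
  have main : ∀ Y : E → E, BoundedSmooth Y →
      ∃ L : ℝ≥0, ∀ t ∈ Icc 0 T, LipschitzOnWith L (flow Y t) (closedBall x₀ r) := by
    intro Y hY
    obtain ⟨M, hM, hb⟩ := hY.bounded
    obtain ⟨K, hK⟩ := exists_lipschitzOnWith_closedBall (hY.contDiff.of_le (by simp)) x₀ (r + M * T)
    refine ⟨⟨Real.exp (K * T), (Real.exp_pos _).le⟩, fun t ht => LipschitzOnWith.of_dist_le_mul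
      fun x hx y hy => ?_⟩
    have := dist_le_of_trajectories_ODE_of_mem (v := fun _ => Y) (a := 0) (b := T)
      (s := fun _ => closedBall x₀ (r + M * T)) (fun _ _ => hK)
      (hY.continuous_flow_left x).continuousOn
      (fun s _ => (hY.hasDerivAt_flow s x).hasDerivWithinAt)
      (fun s hs => hY.flow_mem_closedBall hM hb (by rw [abs_of_nonneg hs.1]; exact hs.2.le) hx)
      (hY.continuous_flow_left y).continuousOn
      (fun s _ => (hY.hasDerivAt_flow s y).hasDerivWithinAt)
      (fun s hs => hY.flow_mem_closedBall hM hb (by rw [abs_of_nonneg hs.1]; exact hs.2.le) hy)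
      le_rfl t ht
    rw [hY.flow_zero, hY.flow_zero] at this
    refine this.trans ?_
    rw [mul_comm]
    change _ ≤ Real.exp (K * T) * dist x y
    gcongr
    linarith [ht.2]
  obtain ⟨L₁, h₁⟩ := main X hX
  obtain ⟨L₂, h₂⟩ := main (-X) hX.neg
  refine ⟨max L₁ L₂, fun t ht => ?_⟩
  rcases le_total 0 t with h | h
  · exact (h₁ t ⟨h, ht.2⟩).weaken (le_max_left _ _)
  · have := h₂ (-t) ⟨by linarith, by linarith [ht.1]⟩
    have he : flow (-X) (-t) = flow X t := by
      funext x
      rw [hX.flow_neg, neg_neg]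
    rw [he] at this
    exact this.weaken (le_max_right _ _)

lemma continuous_flow (hX : BoundedSmooth X) : Continuous fun p : ℝ × E => flow X p.1 p.2 := by
  rw [continuous_iff_continuousAt]
  rintro ⟨t, x⟩
  obtain ⟨L, hL⟩ := hX.exists_lipschitz_flow x 1 (|t| + 1)
  have hc : ContinuousOn (fun p : E × ℝ => flow X p.2 p.1)
      (closedBall x 1 ×ˢ Icc (-(|t| + 1)) (|t| + 1)) :=
    continuousOn_prod_of_continuousOn_lipschitzOnWith _ L
      (fun y _ => (hX.continuous_flow_left y).continuousOn) hL
  have hn : closedBall x 1 ×ˢ Icc (-(|t| + 1)) (|t| + 1) ∈ 𝓝 (x, t) :=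
    prod_mem_nhds (closedBall_mem_nhds x one_pos)
      (Icc_mem_nhds (by linarith [neg_abs_le t]) (by linarith [le_abs_self t]))
  have h2 : ContinuousAt (fun p : ℝ × E => (p.2, p.1)) (t, x) := continuous_swap.continuousAt
  exact ContinuousAt.comp (f := fun p : ℝ × E => (p.2, p.1)) (x := (t, x))
    (g := fun p : E × ℝ => flow X p.2 p.1) (hc.continuousAt hn) h2

lemma continuous_flow_right (hX : BoundedSmooth X) (t : ℝ) : Continuous (flow X t) :=
  hX.continuous_flow.comp (Continuous.prodMk_right t)

/-- The time-`t` map of a flow. -/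
noncomputable def flowHomeomorph (hX : BoundedSmooth X) (t : ℝ) : E ≃ₜ E where
  toFun := flow X t
  invFun := flow X (-t)
  left_inv := hX.flow_neg_flow t
  right_inv := hX.flow_flow_neg t
  continuous_toFun := hX.continuous_flow_right t
  continuous_invFun := hX.continuous_flow_right (-t)

end BoundedSmooth

end Flow

/-! ### Differentiability of the flow in the initial point -/

section FlowDeriv

variable {E : Type*} [NormedAddCommGroup E] [NormedSpace ℝ E] [FiniteDimensional ℝ E] {X : E → E}

/-- First order Taylor estimate with a quadratic remainder, uniform on a ball. -/
lemma exists_taylor_bound (hX : ContDiff ℝ ∞ X) (x₀ : E) (r : ℝ) :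
    ∃ C : ℝ≥0, ∀ x ∈ closedBall x₀ r, ∀ y ∈ closedBall x₀ r,
      ‖X y - X x - fderiv ℝ X x (y - x)‖ ≤ C * ‖y - x‖ ^ 2 := by
  obtain ⟨C, hC⟩ := exists_lipschitzOnWith_closedBall
    (hX.fderiv_right (m := 1) (by norm_cast)) x₀ r
  refine ⟨C, fun x hx y hy => ?_⟩
  have hseg : segment ℝ x y ⊆ closedBall x₀ r := (convex_closedBall x₀ r).segment_subset hx hy
  have := Convex.norm_image_sub_le_of_norm_hasFDerivWithin_le' (f := X) (f' := fderiv ℝ X)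
    (φ := fderiv ℝ X x) (C := C * ‖y - x‖) (s := segment ℝ x y) (x := x) (y := y)
    (fun z _ => ((hX.differentiable (by simp)) z).hasFDerivAt.hasFDerivWithinAt)
    (fun z hz => by
      refine (hC.norm_sub_le (hseg hz) hx).trans ?_
      gcongr
      obtain ⟨θ, hθ, rfl⟩ := (segment_eq_image' ℝ x y) ▸ hz
      rw [add_sub_cancel_left, norm_smul, Real.norm_eq_abs, abs_of_nonneg hθ.1]
      exact mul_le_of_le_one_left (norm_nonneg _) hθ.2)
    (convex_segment x y) (left_mem_segment ℝ x y) (right_mem_segment ℝ x y)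
  rwa [mul_assoc, ← pow_two] at this

/-- A solution of the variational equation along a trajectory is the derivative of the flow: by
Grönwall's inequality the linearization error is quadratic in the displacement. -/
lemma BoundedSmooth.hasFDerivAt_of_variational (hX : BoundedSmooth X) {t : ℝ} (ht : 0 ≤ t) (x : E)
    {A : ℝ → E →L[ℝ] E} (hA0 : A 0 = ContinuousLinearMap.id ℝ E)
    (hA : ∀ s ∈ Icc 0 t, HasDerivAt A ((fderiv ℝ X (flow X s x)).comp (A s)) s) :
    HasFDerivAt (flow X t) (A t) x := by
  obtain ⟨M, hM, hb⟩ := hX.bounded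
  obtain ⟨L, hL⟩ := hX.exists_lipschitz_flow x 1 t
  obtain ⟨C, hC⟩ := exists_taylor_bound hX.contDiff x (1 + M * t)
  obtain ⟨K₀, hK₀⟩ := (isCompact_Icc (a := (0 : ℝ)) (b := t)).exists_bound_of_continuousOn
    (f := fun s => fderiv ℝ X (flow X s x))
    ((hX.contDiff.continuous_fderiv (by simp)).comp (hX.continuous_flow_left x)).continuousOn
  set K := max K₀ 1
  have hK : 0 < K := lt_of_lt_of_le one_pos (le_max_right _ _)
  have hx1 : x ∈ closedBall x 1 := mem_closedBall_self zero_le_one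
  have est : ∀ y ∈ closedBall x 1, ‖flow X t y - flow X t x - A t (y - x)‖ ≤
      (C * L ^ 2 / K * (Real.exp (K * t) - 1)) * ‖y - x‖ ^ 2 := by
    intro y hy
    have hr : ∀ s ∈ Icc 0 t, HasDerivAt (fun s => flow X s y - flow X s x - A s (y - x))
        (X (flow X s y) - X (flow X s x) - fderiv ℝ X (flow X s x) (A s (y - x))) s := by
      intro s hs
      have h1 := (hA s hs).clm_apply (hasDerivAt_const s (y - x))
      have h2 := ((hX.hasDerivAt_flow s y).fun_sub (hX.hasDerivAt_flow s x)).fun_sub h1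
      simpa only [ContinuousLinearMap.comp_apply, map_zero, add_zero] using h2
    have := norm_le_gronwallBound_of_norm_deriv_right_le (δ := 0) (K := K)
      (ε := C * (L * ‖y - x‖) ^ 2) (a := 0) (b := t)
      (fun s hs => (hr s hs).continuousAt.continuousWithinAt)
      (fun s hs => (hr s (Ico_subset_Icc_self hs)).hasDerivWithinAt)
      (by simp [hX.flow_zero, hA0]) (fun s hs => ?_) t ⟨ht, le_rfl⟩
    · refine this.trans (le_of_eq ?_)
      rw [gronwallBound_of_K_ne_0 hK.ne']
      simp only [sub_zero]
      ring
    · have hs' : |s| ≤ t := by rw [abs_of_nonneg hs.1]; exact hs.2.le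
      have e : X (flow X s y) - X (flow X s x) - fderiv ℝ X (flow X s x) (A s (y - x)) =
          fderiv ℝ X (flow X s x) (flow X s y - flow X s x - A s (y - x)) +
          (X (flow X s y) - X (flow X s x)
            - fderiv ℝ X (flow X s x) (flow X s y - flow X s x)) := by
        simp only [map_sub]
        abel
      rw [e]
      refine (norm_add_le _ _).trans (add_le_add ?_ ?_)
      · refine (ContinuousLinearMap.le_opNorm _ _).trans ?_
        gcongr
        exact (hK₀ s (Ico_subset_Icc_self hs)).trans (le_max_left _ _)
      · refine (hC _ (hX.flow_mem_closedBall hM hb hs' hx1) _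
          (hX.flow_mem_closedBall hM hb hs' hy)).trans ?_
        gcongr
        exact (hL s ⟨by linarith [hs.1], hs.2.le⟩).norm_sub_le hy hx1
  rw [hasFDerivAt_iff_isLittleO]
  refine Asymptotics.IsBigO.trans_isLittleO (g := fun y => ‖y - x‖ ^ 2)
    (Asymptotics.IsBigO.of_bound (C * L ^ 2 / K * (Real.exp (K * t) - 1)) ?_) ?_
  · filter_upwards [closedBall_mem_nhds x one_pos] with y hy
    simpa using est y hy
  · have h0 : Tendsto (fun y => y - x) (𝓝 x) (𝓝 0) := by
      simpa using (continuous_sub_right x).tendsto x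
    exact (Asymptotics.isLittleO_norm_pow_id one_lt_two).comp_tendsto h0

/-- Existence and joint continuity of solutions of the variational equation. They are components of
the flow of the field `(x, A) ↦ (X x, DX(x) ∘ A)`, cut off by bump functions so that it becomes
bounded without changing on the relevant trajectories. -/
lemma BoundedSmooth.exists_variational (hX : BoundedSmooth X) (x₀ : E) {T : ℝ} (hT : 0 < T) :
    ∃ Ψ : ℝ → E → E →L[ℝ] E, Continuous (fun p : ℝ × E => Ψ p.1 p.2) ∧
      (∀ x, Ψ 0 x = ContinuousLinearMap.id ℝ E) ∧
      ∀ x ∈ closedBall x₀ 1, ∀ t ∈ Icc (-T) T,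
        HasDerivAt (fun t => Ψ t x) ((fderiv ℝ X (flow X t x)).comp (Ψ t x)) t := by
  obtain ⟨M, hM, hb⟩ := hX.bounded
  have : ProperSpace E := FiniteDimensional.proper ℝ E
  obtain ⟨K₀, hK₀⟩ := (isCompact_closedBall x₀ (2 + M * T)).exists_bound_of_continuousOn
    (f := fun x => fderiv ℝ X x) (hX.contDiff.continuous_fderiv (by simp)).continuousOn
  set K := max K₀ 0
  have hK : 0 ≤ K := le_max_right _ _
  let χ₁ : ContDiffBump x₀ := ⟨1 + M * T, 2 + M * T, by positivity, by linarith⟩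
  let χ₂ : ContDiffBump (0 : E →L[ℝ] E) :=
    ⟨Real.exp (K * T), Real.exp (K * T) + 1, by positivity, by linarith⟩
  have hχ₁ : ∀ x, χ₁ x * ‖fderiv ℝ X x‖ ≤ K := by
    intro x
    by_cases hx : x ∈ closedBall x₀ (2 + M * T)
    · calc χ₁ x * ‖fderiv ℝ X x‖ ≤ 1 * K :=
            mul_le_mul χ₁.le_one ((hK₀ x hx).trans (le_max_left _ _)) (norm_nonneg _) zero_le_one
        _ = K := one_mul _
    · rw [χ₁.zero_of_le_dist (le_of_lt (by simpa using hx)), zero_mul]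
      exact hK
  have hχ₂ : ∀ A : E →L[ℝ] E, χ₂ A * ‖A‖ ≤ Real.exp (K * T) + 1 := by
    intro A
    rcases le_total (Real.exp (K * T) + 1) ‖A‖ with h | h
    · rw [χ₂.zero_of_le_dist (by simpa using h), zero_mul]
      positivity
    · calc χ₂ A * ‖A‖ ≤ 1 * ‖A‖ := by gcongr; exact χ₂.le_one
        _ ≤ _ := by rwa [one_mul]
  let Z : E × (E →L[ℝ] E) → E →L[ℝ] E :=
    fun p => (χ₁ p.1 * χ₂ p.2) • (fderiv ℝ X p.1).comp p.2
  have hZ : ∀ p, ‖Z p‖ ≤ K * (χ₂ p.2 * ‖p.2‖) := by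
    intro p
    have h0 : 0 ≤ χ₁ p.1 := χ₁.nonneg
    have h1 : 0 ≤ χ₂ p.2 := χ₂.nonneg
    calc ‖Z p‖ ≤ (χ₁ p.1 * χ₂ p.2) * (‖fderiv ℝ X p.1‖ * ‖p.2‖) := by
          simp only [Z]
          rw [norm_smul, Real.norm_eq_abs, abs_of_nonneg (by positivity)]
          gcongr
          exact ContinuousLinearMap.opNorm_comp_le _ _
      _ = (χ₁ p.1 * ‖fderiv ℝ X p.1‖) * (χ₂ p.2 * ‖p.2‖) := by ring
      _ ≤ _ := by gcongr; exact hχ₁ _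
  let Y : E × (E →L[ℝ] E) → E × (E →L[ℝ] E) := fun p => (X p.1, Z p)
  have hY : BoundedSmooth Y := by
    refine ⟨?_, max M (K * (Real.exp (K * T) + 1)), le_max_of_le_left hM, fun p => ?_⟩
    · refine (hX.contDiff.comp contDiff_fst).prodMk (ContDiff.fun_smul ?_ ?_)
      · exact (χ₁.contDiff.comp contDiff_fst).mul (χ₂.contDiff.comp contDiff_snd)
      · exact ((hX.contDiff.fderiv_right (m := ∞) (by simp)).comp contDiff_fst).clm_comp
          contDiff_snd
    · exact max_le_max (hb _) ((hZ p).trans (by gcongr; exact hχ₂ _))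
  let I : E →L[ℝ] E := ContinuousLinearMap.id ℝ E
  have hfst : ∀ t x, (flow Y t (x, I)).1 = flow X t x := by
    intro t x
    have := hX.eq_flow (γ := fun t => (flow Y t (x, I)).1)
      (fun t => (ContinuousLinearMap.fst ℝ E (E →L[ℝ] E)).hasFDerivAt.comp_hasDerivAt t
        (hY.hasDerivAt_flow t (x, I))) t
    simpa [hY.flow_zero] using this
  have hsnd : ∀ t x, HasDerivAt (fun t => (flow Y t (x, I)).2) (Z (flow Y t (x, I))) t :=
    fun t x => (ContinuousLinearMap.snd ℝ E (E →L[ℝ] E)).hasFDerivAt.comp_hasDerivAt t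
      (hY.hasDerivAt_flow t (x, I))
  have hnorm : ∀ p, ‖Z p‖ ≤ K * ‖p.2‖ := fun p => (hZ p).trans (by
    gcongr
    exact mul_le_of_le_one_left (norm_nonneg _) χ₂.le_one)
  have hI : ‖I‖ ≤ 1 := ContinuousLinearMap.norm_id_le
  have hbound : ∀ x, ∀ t ∈ Icc (-T) T, ‖(flow Y t (x, I)).2‖ ≤ Real.exp (K * T) := by
    intro x t ht
    have aux : ∀ (B B' : ℝ → E →L[ℝ] E), (∀ s, HasDerivAt B (B' s) s) → ‖B 0‖ ≤ 1 →
        (∀ s, ‖B' s‖ ≤ K * ‖B s‖) → ∀ s ∈ Icc 0 T, ‖B s‖ ≤ Real.exp (K * T) := by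
      intro B B' hB h0 hB' s hs
      have := norm_le_gronwallBound_of_norm_deriv_right_le (δ := 1) (K := K) (ε := 0) (a := 0)
        (b := T) (fun s _ => (hB s).continuousAt.continuousWithinAt)
        (fun s _ => (hB s).hasDerivWithinAt) h0 (fun s _ => by simpa using hB' s) s hs
      rw [gronwallBound_ε0, one_mul, sub_zero] at this
      refine this.trans ?_
      gcongr
      exact hs.2
    rcases le_total 0 t with h | h
    · exact aux (fun t => (flow Y t (x, I)).2) _ (fun s => hsnd s x)
        (by simpa [hY.flow_zero] using hI) (fun s => hnorm _) t ⟨h, ht.2⟩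
    · have := aux (fun t => (flow Y (-t) (x, I)).2) (fun t => -Z (flow Y (-t) (x, I)))
        (fun s => by
          have h : HasDerivAt (fun t => (flow Y (-t) (x, I)).2) _ s :=
            (hsnd (-s) x).scomp s (hasDerivAt_neg s)
          simpa using h)
        (by simpa [hY.flow_zero] using hI) (fun s => by simpa using hnorm _) (-t)
        ⟨by linarith, by linarith [ht.1]⟩
      simpa using this
  refine ⟨fun t x => (flow Y t (x, I)).2, ?_, fun x => by simp [hY.flow_zero, I], ?_⟩
  · exact continuous_snd.comp (hY.continuous_flow.comp
      (continuous_fst.prodMk (continuous_snd.prodMk continuous_const)))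
  · intro x hx t ht
    have h1 : χ₁ (flow X t x) = 1 := by
      exact χ₁.one_of_mem_closedBall (hX.flow_mem_closedBall hM hb (abs_le.2 ht) hx)
    have h2 : χ₂ (flow Y t (x, I)).2 = 1 :=
      χ₂.one_of_mem_closedBall (by simpa using hbound x t ht)
    have := hsnd t x
    simp only [Z, hfst, h1, h2, mul_one, one_smul] at this
    exact this

namespace BoundedSmooth

/-- Near a given initial point and up to a given time, solutions of the variational equation are the
derivatives of the flow. -/
lemma exists_hasFDerivAt_flow (hX : BoundedSmooth X) (x₀ : E) {T : ℝ} (hT : 0 < T) :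
    ∃ Ψ : ℝ → E → E →L[ℝ] E, Continuous (fun p : ℝ × E => Ψ p.1 p.2) ∧
      ∀ x ∈ closedBall x₀ 1, ∀ t ∈ Icc (-T) T,
        HasDerivAt (fun t => Ψ t x) ((fderiv ℝ X (flow X t x)).comp (Ψ t x)) t ∧
        HasFDerivAt (flow X t) (Ψ t x) x := by
  obtain ⟨Ψ, hc, h0, hd⟩ := hX.exists_variational x₀ hT
  refine ⟨Ψ, hc, fun x hx t ht => ⟨hd x hx t ht, ?_⟩⟩
  rcases le_total 0 t with h | h
  · exact hX.hasFDerivAt_of_variational h x (h0 x)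
      (fun s hs => hd x hx s ⟨by linarith [hs.1], hs.2.trans ht.2⟩)
  · have := hX.neg.hasFDerivAt_of_variational (t := -t) (A := fun s => Ψ (-s) x)
      (by linarith) x (by simpa using h0 x) (fun s hs => by
        have h1 : HasDerivAt (fun s => Ψ (-s) x) _ s :=
          (hd x hx (-s) ⟨by linarith [hs.2, ht.1], by linarith [hs.1]⟩).scomp s (hasDerivAt_neg s)
        have h2 : fderiv ℝ (-X) = fun y => -fderiv ℝ X y := by
          funext y
          exact fderiv_neg
        rw [h2, hX.flow_neg, ContinuousLinearMap.neg_comp]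
        simpa using h1)
    have he : flow (-X) (-t) = flow X t := by
      funext y
      rw [hX.flow_neg, neg_neg]
    simpa [he] using this

lemma hasFDerivAt_flow (hX : BoundedSmooth X) (t : ℝ) (x : E) :
    HasFDerivAt (flow X t) (fderiv ℝ (flow X t) x) x := by
  obtain ⟨Ψ, -, h⟩ := hX.exists_hasFDerivAt_flow x (T := |t| + 1) (by positivity)
  exact (h x (mem_closedBall_self zero_le_one) t
    ⟨by linarith [neg_abs_le t], by linarith [le_abs_self t]⟩).2.differentiableAt.hasFDerivAt

omit [FiniteDimensional ℝ E] in
lemma eventually_fderiv_flow_eq {Ψ : ℝ → E → E →L[ℝ] E} {x₀ : E} {t₀ : ℝ}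
    (h : ∀ x ∈ closedBall x₀ 1, ∀ t ∈ Icc (-(|t₀| + 1)) (|t₀| + 1),
        HasDerivAt (fun t => Ψ t x) ((fderiv ℝ X (flow X t x)).comp (Ψ t x)) t ∧
        HasFDerivAt (flow X t) (Ψ t x) x) :
    ∀ᶠ p : ℝ × E in 𝓝 (t₀, x₀), fderiv ℝ (flow X p.1) p.2 = Ψ p.1 p.2 := by
  have hn : Icc (-(|t₀| + 1)) (|t₀| + 1) ×ˢ closedBall x₀ 1 ∈ 𝓝 (t₀, x₀) :=
    prod_mem_nhds (Icc_mem_nhds (by linarith [neg_abs_le t₀]) (by linarith [le_abs_self t₀]))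
      (closedBall_mem_nhds x₀ one_pos)
  filter_upwards [hn] with p hp
  exact (h p.2 hp.2 p.1 hp.1).2.fderiv

lemma continuous_fderiv_flow (hX : BoundedSmooth X) :
    Continuous fun p : ℝ × E => fderiv ℝ (flow X p.1) p.2 := by
  rw [continuous_iff_continuousAt]
  rintro ⟨t, x⟩
  obtain ⟨Ψ, hc, h⟩ := hX.exists_hasFDerivAt_flow x (T := |t| + 1) (by positivity)
  exact hc.continuousAt.congr ((eventually_fderiv_flow_eq h).mono fun p hp => hp.symm)

/-- The variational equation. -/
lemma hasDerivAt_fderiv_flow (hX : BoundedSmooth X) (t : ℝ) (x : E) :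
    HasDerivAt (fun t => fderiv ℝ (flow X t) x)
      ((fderiv ℝ X (flow X t x)).comp (fderiv ℝ (flow X t) x)) t := by
  obtain ⟨Ψ, hc, h⟩ := hX.exists_hasFDerivAt_flow x (T := |t| + 1) (by positivity)
  have hev := eventually_fderiv_flow_eq h
  have hev' : (fun t => fderiv ℝ (flow X t) x) =ᶠ[𝓝 t] fun t => Ψ t x :=
    ((Continuous.prodMk_left x).tendsto t).eventually hev
  have := (h x (mem_closedBall_self zero_le_one) t
    ⟨by linarith [neg_abs_le t], by linarith [le_abs_self t]⟩).1.congr_of_eventuallyEq hev'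
  rwa [← hev'.eq_of_nhds] at this

lemma fderiv_flow_zero (hX : BoundedSmooth X) (x : E) :
    fderiv ℝ (flow X 0) x = ContinuousLinearMap.id ℝ E := by
  have : flow X 0 = id := funext hX.flow_zero
  rw [this, fderiv_id]

lemma fderiv_flow_neg_comp (hX : BoundedSmooth X) (t : ℝ) (x : E) :
    (fderiv ℝ (flow X (-t)) (flow X t x)).comp (fderiv ℝ (flow X t) x) =
      ContinuousLinearMap.id ℝ E := by
  have h := (hX.hasFDerivAt_flow (-t) (flow X t x)).comp x (hX.hasFDerivAt_flow t x)
  have he : flow X (-t) ∘ flow X t = id := funext (hX.flow_neg_flow t)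
  rw [he] at h
  exact h.unique (hasFDerivAt_id x)

lemma fderiv_flow_injective (hX : BoundedSmooth X) (t : ℝ) (x : E) :
    Function.Injective (fderiv ℝ (flow X t) x) := by
  intro v w h
  have := congrArg (fderiv ℝ (flow X (-t)) (flow X t x)) h
  simpa [← ContinuousLinearMap.comp_apply, hX.fderiv_flow_neg_comp] using this

/-- A field is carried to itself by its flow. -/
lemma fderiv_flow_apply_self (hX : BoundedSmooth X) (t : ℝ) (x : E) :
    fderiv ℝ (flow X t) x (X x) = X (flow X t x) := by
  have h1 : HasDerivAt (fun s => flow X t (flow X s x)) (fderiv ℝ (flow X t) x (X x)) 0 := by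
    have h := hX.hasDerivAt_flow 0 x
    have h2 := hX.hasFDerivAt_flow t (flow X 0 x)
    rw [hX.flow_zero] at h h2
    exact HasFDerivAt.comp_hasDerivAt (f := fun s => flow X s x) 0
      (by simpa [hX.flow_zero] using h2) h
  have h2 : HasDerivAt (fun s => flow X t (flow X s x)) (X (flow X t x)) 0 := by
    have h := (hX.hasDerivAt_flow (t + 0) x).comp_const_add t 0
    simpa only [hX.flow_add, add_zero] using h
  exact h1.unique h2

lemma hasStrictFDerivAt_flow (hX : BoundedSmooth X) (t : ℝ) (x : E) :
    HasStrictFDerivAt (fun p : ℝ × E => flow X p.1 p.2)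
      ((ContinuousLinearMap.toSpanSingleton ℝ (X (flow X t x))).coprod (fderiv ℝ (flow X t) x))
      (t, x) := by
  refine hasStrictFDerivAt_uncurry_coprod (f := flow X) (u := (t, x))
    (f₁ := fun t x => ContinuousLinearMap.toSpanSingleton ℝ (X (flow X t x)))
    (f₂ := fun t x => fderiv ℝ (flow X t) x) ?_ ?_ ?_ ?_
  · exact Eventually.of_forall fun p => (hX.hasDerivAt_flow p.1 p.2).hasFDerivAt
  · exact Eventually.of_forall fun p => hX.hasFDerivAt_flow p.1 p.2
  · have : Continuous fun p : ℝ × E =>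
        ContinuousLinearMap.toSpanSingletonCLE (𝕜 := ℝ) (X (flow X p.1 p.2)) :=
      (ContinuousLinearEquiv.continuous _).comp (hX.contDiff.continuous.comp hX.continuous_flow)
    exact this.continuousAt
  · exact hX.continuous_fderiv_flow.continuousAt

end BoundedSmooth

end FlowDeriv

/-! ### Krener's theorem -/

section Krener

variable {E : Type*} [NormedAddCommGroup E] [NormedSpace ℝ E]

open VectorField

/-- The module over the smooth functions generated by all iterated Lie brackets of the fields `X i`.
Admitting function coefficients makes it insensitive to rescaling the `X i` by smooth positive
functions. -/
inductive InLieModule {ι : Type*} (X : ι → E → E) : (E → E) → Prop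
  | of (i : ι) : InLieModule X (X i)
  | add {Y Z : E → E} (hY : InLieModule X Y) (hZ : InLieModule X Z) : InLieModule X (Y + Z)
  | smul {φ : E → ℝ} {Y : E → E} (hφ : ContDiff ℝ ∞ φ) (hY : InLieModule X Y) :
      InLieModule X (fun x => φ x • Y x)
  | bracket (i : ι) {Y : E → E} (hY : InLieModule X Y) : InLieModule X (lieBracket ℝ (X i) Y)

namespace InLieModule

variable {ι : Type*} {X : ι → E → E}

lemma contDiff (hX : ∀ i, ContDiff ℝ ∞ (X i)) {Y : E → E} (hY : InLieModule X Y) :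
    ContDiff ℝ ∞ Y := by
  induction hY with
  | of i => exact hX i
  | add _ _ ihY ihZ => exact ihY.add ihZ
  | smul hφ _ ih => exact hφ.fun_smul ih
  | bracket i _ ih => exact (hX i).lieBracket_vectorField ih (by simp)

lemma sub {Y Z : E → E} (hY : InLieModule X Y) (hZ : InLieModule X Z) : InLieModule X (Y - Z) := by
  have := hY.add (hZ.smul (φ := fun _ => -1) contDiff_const)
  convert this using 1
  funext x
  simp [sub_eq_add_neg]

/-- The module is closed under brackets of any two of its members, by the Leibniz rule and the
Jacobi identity. -/
lemma lieBracket (hX : ∀ i, ContDiff ℝ ∞ (X i)) {Y Z : E → E} (hY : InLieModule X Y)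
    (hZ : InLieModule X Z) : InLieModule X (lieBracket ℝ Y Z) := by
  induction hY generalizing Z with
  | of i => exact hZ.bracket i
  | @add Y₁ Y₂ h₁ h₂ ih₁ ih₂ =>
    convert! (ih₁ hZ).add (ih₂ hZ) using 1
    funext x
    exact lieBracket_add_left ((h₁.contDiff hX).differentiable (by simp) x)
      ((h₂.contDiff hX).differentiable (by simp) x)
  | @smul φ Y hφ hY ih =>
    have hφ' : ContDiff ℝ ∞ fun x => -(fderiv ℝ φ x (Z x)) :=
      ((hφ.fderiv_right (m := ∞) (by simp)).clm_apply (hZ.contDiff hX)).neg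
    convert! (hY.smul hφ').add ((ih hZ).smul hφ) using 1
    funext x
    exact lieBracket_smul_left (hφ.differentiable (by simp) x)
      ((hY.contDiff hX).differentiable (by simp) x)
  | @bracket i Y hY ih =>
    convert! ((ih hZ).bracket i).sub (ih (hZ.bracket i)) using 1
    funext x
    have := leibniz_identity_lieBracket (𝕜 := ℝ) (n := ∞)
      (by rw [minSmoothness_of_isRCLikeNormedField]; exact WithTop.coe_le_coe.2 le_top) (hX i).contDiffAt
      (hY.contDiff hX).contDiffAt (hZ.contDiff hX).contDiffAt (x := x)
    rw [Pi.sub_apply, this, add_sub_cancel_right]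

lemma of_iteratedBracket (hX : ∀ i, ContDiff ℝ ∞ (X i)) {F : Set (E → E)}
    (hF : ∀ Y ∈ F, InLieModule X Y) {Y : E → E} (hY : IteratedBracket F Y) : InLieModule X Y := by
  induction hY with
  | of h => exact hF _ h
  | bracket h _ ih => exact (hF _ h).lieBracket hX ih

/-- If the module contains a bracket-generating family, its members fill every tangent space. -/
lemma exists_apply_eq (hX : ∀ i, ContDiff ℝ ∞ (X i)) {F : Set (E → E)}
    (hF : ∀ Y ∈ F, InLieModule X Y) (hne : F.Nonempty) (hBG : BracketGenerating F) (p v : E) :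
    ∃ Y, InLieModule X Y ∧ Y p = v := by
  have hv : v ∈ LieSpanAt F p := by rw [hBG p]; trivial
  obtain ⟨Y, hY, rfl⟩ := hv
  refine ⟨Y, ?_, rfl⟩
  obtain ⟨Y₀, hY₀⟩ := hne
  refine Submodule.span_induction (p := fun Y _ => InLieModule X Y) ?_ ?_ ?_ ?_ hY
  · exact fun Y hY => of_iteratedBracket hX hF hY
  · convert (hF Y₀ hY₀).smul (φ := fun _ => 0) contDiff_const using 1
    funext x
    simp
  · exact fun Y Z _ _ hY hZ => hY.add hZ
  · exact fun c Y _ hY => hY.smul (φ := fun _ => c) contDiff_const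

end InLieModule

/-- `V` is the image of the derivative, at a parameter sent to `q`, of a strictly differentiable
parametrized family of points of `A`. -/
def ReachTangent (A : Set E) (q : E) (V : Submodule ℝ E) : Prop :=
  ∃ (W : Type) (_ : NormedAddCommGroup W) (_ : NormedSpace ℝ W) (_ : CompleteSpace W)
    (F : W → E) (F' : W →L[ℝ] E) (w₀ : W), F w₀ = q ∧ HasStrictFDerivAt F F' w₀ ∧
      F'.range = V ∧ ∀ᶠ w in 𝓝 w₀, F w ∈ A

lemma reachTangent_bot {A : Set E} {q : E} (hq : q ∈ A) : ReachTangent A q ⊥ := by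
  refine ⟨ℝ, inferInstance, inferInstance, inferInstance, fun _ => q, 0, 0, rfl,
    hasStrictFDerivAt_const q 0, ?_, Eventually.of_forall fun _ => hq⟩
  ext v
  simp

lemma ReachTangent.mem_nhds [CompleteSpace E] {A : Set E} {q : E} (h : ReachTangent A q ⊤) :
    A ∈ 𝓝 q := by
  obtain ⟨W, _, _, _, F, F', w₀, rfl, hF, hr, hA⟩ := h
  rw [← hF.map_nhds_eq_of_surj hr]
  exact hA

variable [FiniteDimensional ℝ E]

/-- Moving along the flow of `X` for a variable positive time transports a tangent space and adds the
direction `X` to it. -/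
lemma ReachTangent.exists_flow {A : Set E} {q : E} {V : Submodule ℝ E} (h : ReachTangent A q V)
    {X : E → E} (hX : BoundedSmooth X) (hinv : ∀ t, 0 ≤ t → ∀ x ∈ A, flow X t x ∈ A) {t : ℝ}
    (ht : 0 < t) : ∃ V', ReachTangent A (flow X t q) V' ∧
      V.map (fderiv ℝ (flow X t) q : E →ₗ[ℝ] E) ≤ V' ∧ X (flow X t q) ∈ V' := by
  obtain ⟨W, _, _, _, F, F', w₀, rfl, hF, rfl, hA⟩ := h
  have h1 : HasStrictFDerivAt (fun p : W × ℝ => (p.2, F p.1))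
      ((ContinuousLinearMap.snd ℝ W ℝ).prod (F'.comp (ContinuousLinearMap.fst ℝ W ℝ))) (w₀, t) :=
    hasStrictFDerivAt_snd.prodMk (HasStrictFDerivAt.comp (w₀, t) hF hasStrictFDerivAt_fst)
  have h2 := HasStrictFDerivAt.comp (w₀, t) (hX.hasStrictFDerivAt_flow t (F w₀)) h1
  refine ⟨_, ⟨W × ℝ, inferInstance, inferInstance, inferInstance, fun p => flow X p.2 (F p.1), _,
    (w₀, t), rfl, h2, rfl, ?_⟩, ?_, ?_⟩
  · have e1 : ∀ᶠ p : W × ℝ in 𝓝 (w₀, t), F p.1 ∈ A :=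
      (continuous_fst.tendsto (w₀, t)).eventually hA
    have e2 : ∀ᶠ p : W × ℝ in 𝓝 (w₀, t), 0 < p.2 := 
      (continuous_snd.tendsto (w₀, t)).eventually (lt_mem_nhds ht)
    filter_upwards [e1, e2] with p hp1 hp2
    exact hinv _ hp2.le _ hp1
  · rintro _ ⟨_, ⟨w, rfl⟩, rfl⟩
    exact ⟨(w, 0), by simp⟩
  · exact ⟨(0, 1), by simp⟩

/-- If `Z` stays in the subspace `V` transported by the flow of `X`, then `[X, Z]` lies in `V`. -/
lemma BoundedSmooth.lieBracket_mem {X : E → E} (hX : BoundedSmooth X) {Z : E → E}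
    (hZ : ContDiff ℝ ∞ Z) {V : Submodule ℝ E} {q : E} (hq : Z q ∈ V)
    (h : ∀ t, 0 < t → Z (flow X t q) ∈ V.map (fderiv ℝ (flow X t) q : E →ₗ[ℝ] E)) :
    lieBracket ℝ X Z q ∈ V := by
  have hg : HasDerivAt (fun t => Z (flow X t q) - fderiv ℝ (flow X t) q (Z q))
      (lieBracket ℝ X Z q) 0 := by
    have h1 : HasDerivAt (fun t => Z (flow X t q)) (fderiv ℝ Z q (X q)) 0 := by
      have h := hX.hasDerivAt_flow 0 q
      rw [hX.flow_zero] at h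
      refine HasFDerivAt.comp_hasDerivAt (f := fun s => flow X s q) 0 ?_ h
      rw [hX.flow_zero]
      exact (hZ.differentiable (by simp) q).hasFDerivAt
    have h2 := (hX.hasDerivAt_fderiv_flow 0 q).clm_apply (hasDerivAt_const 0 (Z q))
    simpa [hX.flow_zero, hX.fderiv_flow_zero, lieBracket] using h1.fun_sub h2
  have hlim := hg.tendsto_slope_zero_right
  have hC : Tendsto (fun t => fderiv ℝ (flow X (-t)) (flow X t q)) (𝓝[>] 0)
      (𝓝 (ContinuousLinearMap.id ℝ E)) := by
    have hc : Continuous fun t => fderiv ℝ (flow X (-t)) (flow X t q) :=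
      hX.continuous_fderiv_flow.comp (continuous_neg.prodMk (hX.continuous_flow_left q))
    have := (hc.tendsto 0).mono_left (nhdsWithin_le_nhds (s := Ioi 0))
    simpa [hX.fderiv_flow_zero] using this
  -- Pulling the difference quotients back to `q` places them in the fixed closed subspace `V`.
  have hlim2 : Tendsto (fun t => fderiv ℝ (flow X (-t)) (flow X t q) _) _ _ :=
    (isBoundedBilinearMap_apply (𝕜 := ℝ) (E := E) (F := E)).continuous.tendsto _ |>.comp
      (hC.prodMk_nhds hlim)
  rw [ContinuousLinearMap.id_apply] at hlim2
  have : CompleteSpace E := FiniteDimensional.complete ℝ E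
  refine V.closed_of_finiteDimensional.mem_of_tendsto hlim2 ?_
  filter_upwards [self_mem_nhdsWithin] with t ht
  obtain ⟨v, hv, hv'⟩ := h t ht
  have e : fderiv ℝ (flow X (-t)) (flow X t q) (Z (flow X t q) - fderiv ℝ (flow X t) q (Z q)) =
      v - Z q := by
    rw [← hv']
    simp only [map_sub]
    have := fun w => congrArg (fun L : E →L[ℝ] E => L w) (hX.fderiv_flow_neg_comp t q)
    simpa using congrArg₂ (· - ·) (this v) (this (Z q))
  simp only [zero_add, hX.flow_zero, hX.fderiv_flow_zero, ContinuousLinearMap.id_apply, sub_self,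
    sub_zero, map_smul]
  rw [e]
  exact V.smul_mem _ (V.sub_mem hv hq)

/-- **Krener's theorem**: a nonempty set which is invariant under the forward flows of fields whose
iterated brackets fill every tangent space has nonempty interior. A tangent space of maximal
dimension contains all members of the Lie module, because it cannot grow along the flows. -/
theorem interior_nonempty_of_flow_invariant {ι : Type*} {X : ι → E → E}
    (hX : ∀ i, BoundedSmooth (X i)) {A : Set E} (hA : A.Nonempty)
    (hinv : ∀ i t, 0 ≤ t → ∀ x ∈ A, flow (X i) t x ∈ A)
    (hgen : ∀ p v, ∃ Y, InLieModule X Y ∧ Y p = v) : (interior A).Nonempty := by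
  have hsm : ∀ i, ContDiff ℝ ∞ (X i) := fun i => (hX i).contDiff
  obtain ⟨a, ha⟩ := hA
  obtain ⟨N, ⟨⟨q₀, V₀, hV₀, hN₀⟩, hN⟩⟩ : ∃ N, (∃ q V, ReachTangent A q V ∧
      Module.finrank ℝ V = N) ∧ ∀ q V, ReachTangent A q V → Module.finrank ℝ V ≤ N := by
    let D : Set ℕ := {n | ∃ q V, ReachTangent A q V ∧ Module.finrank ℝ V = n}
    have hne : D.Nonempty := ⟨_, a, ⊥, reachTangent_bot ha, rfl⟩
    have hbd : BddAbove D := ⟨Module.finrank ℝ E, by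
      rintro _ ⟨q, V, -, rfl⟩
      exact Submodule.finrank_le V⟩
    exact ⟨sSup D, Nat.sSup_mem hne hbd, fun q V h => le_csSup hbd ⟨q, V, h, rfl⟩⟩
  have step : ∀ q V, ReachTangent A q V → Module.finrank ℝ V = N → ∀ i t, 0 < t →
      ReachTangent A (flow (X i) t q) (V.map (fderiv ℝ (flow (X i) t) q : E →ₗ[ℝ] E)) ∧
      Module.finrank ℝ (V.map (fderiv ℝ (flow (X i) t) q : E →ₗ[ℝ] E)) = N ∧ X i q ∈ V := by
    intro q V hV hVN i t ht
    obtain ⟨V', hV', hle, hmem⟩ := hV.exists_flow (hX i) (hinv i) ht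
    have hinj := (hX i).fderiv_flow_injective t q
    have hfr : Module.finrank ℝ (V.map (fderiv ℝ (flow (X i) t) q : E →ₗ[ℝ] E)) = N := by
      rw [← hVN]
      exact (Submodule.equivMapOfInjective _ hinj V).finrank_eq.symm
    have heq := Submodule.eq_of_le_of_finrank_le hle ((hN _ _ hV').trans hfr.ge)
    rw [heq]
    refine ⟨hV', heq ▸ hfr, ?_⟩
    rw [← heq, ← (hX i).fderiv_flow_apply_self t q] at hmem
    obtain ⟨v, hv, hv'⟩ := hmem
    rwa [← hinj hv']
  have key : ∀ Y, InLieModule X Y → ∀ q V, ReachTangent A q V → Module.finrank ℝ V = N → Y q ∈ V := by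
    intro Y hY
    induction hY with
    | of i => exact fun q V hV hVN => (step q V hV hVN i 1 one_pos).2.2
    | add _ _ ihY ihZ => exact fun q V hV hVN => V.add_mem (ihY q V hV hVN) (ihZ q V hV hVN)
    | smul _ _ ih => exact fun q V hV hVN => V.smul_mem _ (ih q V hV hVN)
    | bracket i hY ih =>
      intro q V hV hVN
      refine (hX i).lieBracket_mem (hY.contDiff hsm) (ih q V hV hVN) fun t ht => ?_
      obtain ⟨h1, h2, -⟩ := step q V hV hVN i t ht
      exact ih _ _ h1 h2
  have htop : V₀ = ⊤ := by
    rw [Submodule.eq_top_iff']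
    intro v
    obtain ⟨Y, hY, rfl⟩ := hgen q₀ v
    exact key Y hY q₀ V₀ hV₀ hN₀
  have : CompleteSpace E := FiniteDimensional.complete ℝ E
  exact ⟨q₀, mem_interior_iff_mem_nhds.2 (htop ▸ hV₀).mem_nhds⟩

end Krener

/-! ### Liouville's theorem and recurrence -/

section Liouville

open MeasureTheory

variable {E : Type*} [NormedAddCommGroup E] [NormedSpace ℝ E] [FiniteDimensional ℝ E]

lemma trace_eq_sum_apply_single {n : ℕ} (A : (Fin n → ℝ) →L[ℝ] (Fin n → ℝ)) :
    LinearMap.trace ℝ (Fin n → ℝ) A = ∑ i, A (Pi.single i 1) i := by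
  rw [LinearMap.trace_eq_matrix_trace ℝ (Pi.basisFun ℝ (Fin n)), Matrix.trace]
  simp

lemma ContinuousLinearMap.differentiable_det :
    Differentiable ℝ fun A : E →L[ℝ] E => A.det := by
  let b := Module.finBasis ℝ E
  have h : ∀ i j, Differentiable ℝ fun A : E →L[ℝ] E => b.coord i (A (b j)) := fun i j =>
    ((LinearMap.toContinuousLinearMap (b.coord i)).comp
      (ContinuousLinearMap.apply ℝ E (b j))).differentiable
  have e : (fun A : E →L[ℝ] E => A.det) = fun A => ∑ σ : Equiv.Perm (Fin (Module.finrank ℝ E)),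
      ((Equiv.Perm.sign σ : ℤ) : ℝ) * ∏ i, b.coord (σ i) (A (b i)) := by
    funext A
    rw [ContinuousLinearMap.det, ← LinearMap.det_toMatrix b, Matrix.det_apply']
    simp [LinearMap.toMatrix_apply]
  rw [e]
  fun_prop

/-- Jacobi's formula at the identity: the derivative of the determinant is the trace. -/
lemma HasDerivAt.det_of_eq_id {A : ℝ → E →L[ℝ] E} {B : E →L[ℝ] E} {t : ℝ}
    (hA : HasDerivAt A B t) (h : A t = ContinuousLinearMap.id ℝ E) :
    HasDerivAt (fun s => (A s).det) (LinearMap.trace ℝ E B) t := by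
  let b := Module.finBasis ℝ E
  have hd := (ContinuousLinearMap.differentiable_det (E := E)
    (ContinuousLinearMap.id ℝ E)).hasFDerivAt
  set D := fderiv ℝ (fun A : E →L[ℝ] E => A.det) (ContinuousLinearMap.id ℝ E)
  have hD : D B = LinearMap.trace ℝ E B := by
    have h1 : HasDerivAt (fun s : ℝ => ContinuousLinearMap.id ℝ E + s • B) B 0 := by
      simpa using ((hasDerivAt_id (0 : ℝ)).smul_const B).const_add (ContinuousLinearMap.id ℝ E)
    have h2 : HasDerivAt (fun s : ℝ => (ContinuousLinearMap.id ℝ E + s • B).det) (D B) 0 :=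
      HasFDerivAt.comp_hasDerivAt (f := fun s : ℝ => ContinuousLinearMap.id ℝ E + s • B)
        (l := fun A : E →L[ℝ] E => A.det) 0 (by simpa using hd) h1
    set M := LinearMap.toMatrix b b B
    let p := (1 + (Polynomial.X : Polynomial ℝ) • M.map Polynomial.C).det.divX.divX
    have h3 : (fun s : ℝ => (ContinuousLinearMap.id ℝ E + s • B).det) =
        fun s => 1 + M.trace * s + p.eval s * s ^ 2 := by
      funext s
      rw [← Matrix.det_one_add_smul, ContinuousLinearMap.det, ← LinearMap.det_toMatrix b]
      congr 1
      simp [M]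
    have h4 : HasDerivAt (fun s : ℝ => 1 + M.trace * s + p.eval s * s ^ 2) M.trace 0 := by
      have := (((hasDerivAt_id (0 : ℝ)).const_mul M.trace).const_add 1).fun_add
        ((p.hasDerivAt 0).fun_mul ((hasDerivAt_id (0 : ℝ)).fun_pow 2))
      simpa using this
    rw [h3] at h2
    rw [h2.unique h4, LinearMap.trace_eq_matrix_trace ℝ b]
  rw [← hD]
  exact HasFDerivAt.comp_hasDerivAt (f := A) t (by rw [h]; exact hd) hA

namespace BoundedSmooth

variable {X : E → E}

lemma det_fderiv_flow (hX : BoundedSmooth X)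
    (hdiv : ∀ x, LinearMap.trace ℝ E (fderiv ℝ X x : E →L[ℝ] E) = 0) (t : ℝ) (x : E) :
    (fderiv ℝ (flow X t) x).det = 1 := by
  have hmul : ∀ s t, (fderiv ℝ (flow X (s + t)) x).det =
      (fderiv ℝ (flow X s) (flow X t x)).det * (fderiv ℝ (flow X t) x).det := by
    intro s t
    have e : flow X (s + t) = flow X s ∘ flow X t := funext fun y => hX.flow_add s t y
    have := ((hX.hasFDerivAt_flow s (flow X t x)).comp x (hX.hasFDerivAt_flow t x)).fderiv
    rw [e, this, ContinuousLinearMap.det, ContinuousLinearMap.det, ContinuousLinearMap.det,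
      ← LinearMap.det_comp]
    rfl
  have hder : ∀ t, HasDerivAt (fun t => (fderiv ℝ (flow X t) x).det) 0 t := by
    intro t
    have h0 := (hX.hasDerivAt_fderiv_flow 0 (flow X t x)).det_of_eq_id (hX.fderiv_flow_zero _)
    rw [hX.fderiv_flow_zero, ContinuousLinearMap.comp_id, hdiv] at h0
    have h1 := h0.mul_const (fderiv ℝ (flow X t) x).det
    simp only [← hmul, zero_mul] at h1
    have h2 := HasDerivAt.comp_sub_const (a := t) (x := t)
      (f := fun s => (fderiv ℝ (flow X (s + t)) x).det) (by simpa using h1)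
    simpa using h2
  have := is_const_of_deriv_eq_zero (fun t => (hder t).differentiableAt) (fun t => (hder t).deriv)
    t 0
  rw [this, hX.fderiv_flow_zero]
  simp [ContinuousLinearMap.det]

variable [MeasurableSpace E] [BorelSpace E]

/-- **Liouville's theorem**: the flow of a divergence-free field preserves volume. -/
lemma addHaar_image_flow (hX : BoundedSmooth X)
    (hdiv : ∀ x, LinearMap.trace ℝ E (fderiv ℝ X x : E →L[ℝ] E) = 0) (μ : Measure E)
    [μ.IsAddHaarMeasure] (t : ℝ) {s : Set E} (hs : MeasurableSet s) : μ (flow X t '' s) = μ s := by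
  rw [← lintegral_abs_det_fderiv_eq_addHaar_image μ hs
    (fun x _ => (hX.hasFDerivAt_flow t x).hasFDerivWithinAt)
    (hX.flowHomeomorph t).injective.injOn]
  simp [hX.det_fderiv_flow hdiv]

omit [MeasurableSpace E] [BorelSpace E] in
lemma flow_add_of_periodic (hX : BoundedSmooth X) {v : E} (hv : ∀ x, X (v + x) = X x) (t : ℝ)
    (x : E) : flow X t (v + x) = v + flow X t x := by
  have := hX.eq_flow (γ := fun t => v + flow X t x) (fun t => by
    rw [hv]
    exact (hX.hasDerivAt_flow t x).const_add v) t
  simpa [hX.flow_zero] using this.symm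

/-- Recurrence: let `X` be a divergence-free field, periodic under a lattice `L`, with a first
integral `G` whose sublevel sets have finite volume modulo `L`. If a periodic open set is mapped into
itself by the flow of `X`, then it is mapped to a dense subset of itself: on each sublevel set of `G`
the image has the same finite volume. -/
lemma subset_closure_image_flow (hX : BoundedSmooth X)
    (hdiv : ∀ x, LinearMap.trace ℝ E (fderiv ℝ X x : E →L[ℝ] E) = 0) (μ : Measure E)
    [μ.IsAddHaarMeasure] {L : AddSubgroup E} [Countable L] (hL : ∀ v ∈ L, ∀ x, X (v + x) = X x)
    {G : E → ℝ} (hG : Continuous G) (hGX : ∀ t x, G (flow X t x) = G x)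
    (hGL : ∀ v ∈ L, ∀ x, G (v + x) = G x) {D : Set E} (hD : MeasurableSet D)
    (hLD : ∀ x, ∃! v : L, (v : E) + x ∈ D) (hfin : ∀ c, μ ({x | G x < c} ∩ D) ≠ ⊤)
    {U : Set E} (hU : IsOpen U) (hUL : ∀ v ∈ L, ∀ x, v + x ∈ U ↔ x ∈ U) {t : ℝ}
    (hUt : ∀ x ∈ U, flow X t x ∈ U) : U ⊆ closure (flow X t '' U) := by
  intro x hx
  set Φ := hX.flowHomeomorph t
  have hΦ : ∀ y, Φ y = flow X t y := fun _ => rfl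
  have hΦL : ∀ v ∈ L, ∀ y, Φ (v + y) = v + Φ y := fun v hv y => hX.flow_add_of_periodic (hL v hv) t y
  let Uc := U ∩ {y | G y < G x + 1}
  let V := Φ '' Uc
  have hUc : IsOpen Uc := hU.inter (isOpen_lt hG continuous_const)
  have hV : IsOpen V := Φ.isOpenMap _ hUc
  have hVU : V ⊆ Uc := by
    rintro _ ⟨y, hy, rfl⟩
    exact ⟨hUt y hy.1, by simpa [hΦ, hGX] using hy.2⟩
  have hUcL : ∀ v ∈ L, ∀ y, v + y ∈ Uc ↔ y ∈ Uc := fun v hv y => by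
    simp only [Uc, mem_inter_iff, mem_ofPred_eq, hUL v hv, hGL v hv]
  have hVL : ∀ v ∈ L, ∀ y, v + y ∈ V ↔ y ∈ V := by
    have aux : ∀ v ∈ L, ∀ y ∈ V, v + y ∈ V := by
      rintro v hv _ ⟨y, hy, rfl⟩
      exact ⟨v + y, (hUcL v hv y).2 hy, hΦL v hv y⟩
    refine fun v hv y => ⟨fun h => ?_, aux v hv y⟩
    simpa using aux (-v) (L.neg_mem hv) _ h
  have hfd : IsAddFundamentalDomain L D μ :=
    .mk' hD.nullMeasurableSet fun y => by simpa [AddSubgroup.vadd_def] using hLD y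
  have hfd' : IsAddFundamentalDomain L (Φ '' D) μ := by
    refine .mk' (Φ.measurableEmbedding.measurableSet_image.2 hD).nullMeasurableSet fun y => ?_
    have e : ∀ v : L, v +ᵥ y ∈ Φ '' D ↔ (v : E) + Φ.symm y ∈ D := by
      intro v
      rw [AddSubgroup.vadd_def, vadd_eq_add]
      constructor
      · rintro ⟨z, hz, hzy⟩
        have : z = v + Φ.symm y := by
          apply Φ.injective
          rw [hzy, hΦL v v.2, Φ.apply_symm_apply]
        rwa [← this]
      · intro h
        exact ⟨_, h, by rw [hΦL v v.2, Φ.apply_symm_apply]⟩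
    simp only [e]
    exact hLD _
  have hvol : μ (V ∩ D) = μ (Uc ∩ D) := by
    rw [hfd.measure_set_eq hfd' hV.measurableSet (fun v => by
      ext y
      simpa [AddSubgroup.vadd_def] using hVL v v.2 y)]
    rw [← image_inter Φ.injective]
    exact hX.addHaar_image_flow hdiv μ t (hUc.measurableSet.inter hD)
  have hnull : μ ((Uc \ V) ∩ D) = 0 := by
    have hsub : V ∩ D ⊆ Uc ∩ D := inter_subset_inter_left _ hVU
    have hf : μ (V ∩ D) ≠ ⊤ := by
      rw [hvol]
      exact measure_ne_top_of_subset (inter_subset_inter_left _ inter_subset_right) (hfin _)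
    have e : (Uc \ V) ∩ D = (Uc ∩ D) \ (V ∩ D) := by
      ext y
      simp only [mem_inter_iff, Set.mem_sdiff]
      tauto
    rw [e, measure_sdiff hsub (hV.measurableSet.inter hD).nullMeasurableSet hf, hvol, tsub_self]
  have hnull' : μ (Uc \ V) = 0 := by
    refine hfd.measure_zero_of_invariant _ (fun v => ?_) hnull
    ext y
    rw [mem_vadd_set_iff_neg_vadd_mem, AddSubgroup.vadd_def, vadd_eq_add]
    simp only [Set.mem_sdiff, hUcL _ (-v).2, hVL _ (-v).2]
  have hempty : Uc \ closure V = ∅ := by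
    refine (hUc.sdiff isClosed_closure).eq_empty_of_measure_zero (μ := μ)
      (measure_mono_null (sdiff_subset_sdiff_right subset_closure) hnull')
  have hxc : x ∈ Uc := ⟨hx, by simp⟩
  have hxV : x ∈ closure V := by
    by_contra h
    exact (hempty ▸ (⟨hxc, h⟩ : x ∈ Uc \ closure V) : x ∈ (∅ : Set E))
  exact closure_mono (image_mono inter_subset_left) hxV

end BoundedSmooth

end Liouville

/-! ### Control-affine systems with recurrent drift -/

section Control

variable {E : Type*} [NormedAddCommGroup E] [NormedSpace ℝ E] [FiniteDimensional ℝ E] {X Y : E → E}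

/-- The module generated by `X` lies in that generated by `X'` as soon as its generators do. -/
lemma InLieModule.trans {E : Type*} [NormedAddCommGroup E] [NormedSpace ℝ E] {ι κ : Type*}
    {X : ι → E → E} {X' : κ → E → E} (hX' : ∀ k, ContDiff ℝ ∞ (X' k))
    (h : ∀ i, InLieModule X' (X i)) {Z : E → E} (hZ : InLieModule X Z) : InLieModule X' Z := by
  induction hZ with
  | of i => exact h i
  | add _ _ ihY ihZ => exact ihY.add ihZ
  | smul hφ _ ih => exact ih.smul hφ
  | bracket i _ ih => exact (h i).lieBracket hX' ih

/-- A closed set invariant under the forward flows of `X + u Y` for all `u` is invariant under the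
forward flow of every multiple `c Y`: this is the limit of strong controls over short times. The
field `c Y + sin ε X` with `ε` as an additional state makes the limit `ε → 0` an instance of
the continuity of flows. -/
lemma flow_smul_mem_of_isClosed (hX : BoundedSmooth X) (hY : BoundedSmooth Y) {S : Set E}
    (hS : IsClosed S) (hinv : ∀ u t : ℝ, 0 ≤ t → ∀ x ∈ S, flow (X + u • Y) t x ∈ S) (c : ℝ) {t : ℝ}
    (ht : 0 ≤ t) {x : E} (hx : x ∈ S) : flow (c • Y) t x ∈ S := by
  let W : E × ℝ → E × ℝ := fun p => (c • Y p.1 + Real.sin p.2 • X p.1, 0)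
  have hW : BoundedSmooth W := by
    obtain ⟨M, hM, hb⟩ := hX.bounded
    obtain ⟨N, hN, hc⟩ := hY.bounded
    refine ⟨?_, |c| * N + M, by positivity, fun p => ?_⟩
    · refine ContDiff.prodMk (ContDiff.add ?_ (ContDiff.fun_smul ?_ ?_)) contDiff_const
      · exact (hY.contDiff.comp contDiff_fst).const_smul c
      · exact Real.contDiff_sin.comp contDiff_snd
      · exact hX.contDiff.comp contDiff_fst
    · have h1 : ‖c • Y p.1‖ ≤ |c| * N := by
        rw [norm_smul, Real.norm_eq_abs]
        gcongr
        exact hc _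
      have h2 : ‖Real.sin p.2 • X p.1‖ ≤ M := by
        rw [norm_smul, Real.norm_eq_abs]
        exact (mul_le_of_le_one_left (norm_nonneg _) (Real.abs_sin_le_one _)).trans (hb _)
      have h3 := norm_add_le (c • Y p.1) (Real.sin p.2 • X p.1)
      simp only [W, Prod.norm_def, norm_zero]
      exact max_le (by linarith) (by positivity)
  have hfl : ∀ ε, (flow W t (x, ε)).1 = flow (c • Y + Real.sin ε • X) t x := by
    intro ε
    have hZ : BoundedSmooth (c • Y + Real.sin ε • X) := (hY.const_smul c).add (hX.const_smul _)
    have := hW.eq_flow (γ := fun t => (flow (c • Y + Real.sin ε • X) t x, ε)) (fun t => by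
      simpa [W] using (hZ.hasDerivAt_flow t x).prodMk (hasDerivAt_const t ε)) t
    simp only [hZ.flow_zero] at this
    rw [← this]
  have hlim : Tendsto (fun ε => (flow W t (x, ε)).1) (𝓝[>] 0) (𝓝 (flow W t (x, 0)).1) := by
    have hcont : Continuous fun ε : ℝ => (flow W t (x, ε)).1 :=
      continuous_fst.comp ((hW.continuous_flow_right t).comp (Continuous.prodMk_right x))
    exact (hcont.tendsto 0).mono_left nhdsWithin_le_nhds
  have hlim0 : (flow W t (x, 0)).1 = flow (c • Y) t x := by simp [hfl]
  rw [← hlim0]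
  refine hS.mem_of_tendsto hlim ?_
  filter_upwards [Ioo_mem_nhdsGT Real.pi_pos] with ε hε
  have hs : 0 < Real.sin ε := Real.sin_pos_of_pos_of_lt_pi hε.1 hε.2
  have hu : BoundedSmooth (X + (c / Real.sin ε) • Y) := hX.add (hY.const_smul _)
  have e : c • Y + Real.sin ε • X = Real.sin ε • (X + (c / Real.sin ε) • Y) := by
    rw [smul_add, smul_smul, mul_div_cancel₀ _ hs.ne', add_comm]
  rw [hfl, e, hu.flow_const_smul]
  exact hinv _ _ (by positivity) x hx

/-- If `X` and `Y` generate all tangent spaces, then a closed nonempty set which is invariant under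
the forward and backward flows of both is everything: its frontier is invariant too, so Krener's
theorem would give the frontier an interior point. -/
lemma eq_univ_of_flow_mem (hX : BoundedSmooth X) (hY : BoundedSmooth Y)
    (hgen : ∀ p v, ∃ Z, InLieModule ![X, Y] Z ∧ Z p = v) {S : Set E} (hS : IsClosed S)
    (hne : S.Nonempty) (hSX : ∀ t, ∀ x ∈ S, flow X t x ∈ S) (hSY : ∀ t, ∀ x ∈ S, flow Y t x ∈ S) :
    S = univ := by
  have hXY : ∀ i, BoundedSmooth (![X, Y] i) := by
    intro i
    fin_cases i
    exacts [hX, hY]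
  have key : ∀ Z, BoundedSmooth Z → (∀ t, ∀ x ∈ S, flow Z t x ∈ S) →
      ∀ t, ∀ x ∈ frontier S, flow Z t x ∈ frontier S := by
    intro Z hZ h t x hx
    have e : hZ.flowHomeomorph t '' S = S := by
      ext y
      constructor
      · rintro ⟨z, hz, rfl⟩
        exact h t z hz
      · exact fun hy => ⟨flow Z (-t) y, h (-t) y hy, hZ.flow_flow_neg t y⟩
    have := (hZ.flowHomeomorph t).image_frontier S
    rw [e] at this
    rw [← this]
    exact ⟨x, hx, rfl⟩
  have hfr : frontier S = ∅ := by
    by_contra hcon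
    have := interior_nonempty_of_flow_invariant hXY (nonempty_iff_ne_empty.2 hcon)
      (fun i t _ x hx => by
        fin_cases i
        exacts [key X hX hSX t x hx, key Y hY hSY t x hx]) hgen
    rw [interior_frontier hS] at this
    exact this.ne_empty rfl
  have hclopen : IsClopen S := isClopen_iff_frontier_eq_empty.2 hfr
  exact hclopen.eq_univ hne

/-- Let `R` be the reachability relation of the control system `x' = X(x) + u Y(x)`. Suppose that
`X` and `Y` generate all tangent spaces and that the drift `X` is recurrent, in the sense that it maps
an invariant periodic open set to a dense subset of itself. Then every point is reachable from
every other one. -/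
theorem reachable_of_recurrent_drift (hX : BoundedSmooth X) (hY : BoundedSmooth Y)
    (hgen : ∀ p v, ∃ Z, InLieModule ![X, Y] Z ∧ Z p = v) {L : AddSubgroup E} {R : E → E → Prop}
    (hrefl : ∀ x, R x x) (htrans : ∀ x y z, R x y → R y z → R x z)
    (hL : ∀ v ∈ L, ∀ x, R x (v + x))
    (hR : ∀ u t : ℝ, 0 ≤ t → ∀ x, R x (flow (X + u • Y) t x))
    (hrec : ∀ U : Set E, IsOpen U → (∀ v ∈ L, ∀ x, v + x ∈ U ↔ x ∈ U) → ∀ t : ℝ, 0 ≤ t →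
      (∀ x ∈ U, flow X t x ∈ U) → U ⊆ closure (flow X t '' U)) (x y : E) : R x y := by
  have hXu : ∀ u : ℝ, BoundedSmooth (X + u • Y) := fun u => hX.add (hY.const_smul u)
  have hnXu : ∀ u : ℝ, BoundedSmooth (-(X + u • Y)) := fun u => (hXu u).neg
  have gen : ∀ F : ℝ → E → E, (∀ u, ContDiff ℝ ∞ (F u)) → InLieModule F X → InLieModule F Y →
      ∀ p v, ∃ Z, InLieModule F Z ∧ Z p = v := by
    intro F hF h1 h2 p v
    obtain ⟨Z, hZ, hv⟩ := hgen p v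
    refine ⟨Z, hZ.trans hF fun i => ?_, hv⟩
    fin_cases i
    exacts [h1, h2]
  -- The points reachable from `x`, and those from which `y` is reachable.
  let A := {z | R x z}
  let B := {z | R z y}
  have hAinv : ∀ u t : ℝ, 0 ≤ t → ∀ z ∈ A, flow (X + u • Y) t z ∈ A :=
    fun u t ht z hz => htrans _ _ _ hz (hR u t ht z)
  have hA : (interior A).Nonempty := by
    refine interior_nonempty_of_flow_invariant hXu ⟨x, hrefl x⟩ hAinv (gen _ (fun u => (hXu u).contDiff)
      ?_ ?_)
    · simpa using InLieModule.of (X := fun u : ℝ => X + u • Y) 0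
    · simpa using (InLieModule.of (X := fun u : ℝ => X + u • Y) 1).sub (InLieModule.of 0)
  have hB : (interior B).Nonempty := by
    refine interior_nonempty_of_flow_invariant hnXu ⟨y, hrefl y⟩ (fun u t ht z hz => ?_)
      (gen _ (fun u => (hnXu u).contDiff) ?_ ?_)
    · have := hR u t ht (flow (-(X + u • Y)) t z)
      rw [(hXu u).flow_neg, (hXu u).flow_flow_neg] at this
      rw [(hXu u).flow_neg]
      exact htrans _ _ _ this hz
    · simpa using (InLieModule.of (X := fun u : ℝ => -(X + u • Y)) 0).smul (φ := fun _ => -1)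
        contDiff_const
    · simpa using (InLieModule.of (X := fun u : ℝ => -(X + u • Y)) 0).sub (InLieModule.of 1)
  have hU : ∀ u t : ℝ, 0 ≤ t → ∀ z ∈ interior A, flow (X + u • Y) t z ∈ interior A := by
    intro u t ht z hz
    have ho := ((hXu u).flowHomeomorph t).isOpenMap _ (isOpen_interior (s := A))
    refine interior_maximal ?_ ho ⟨z, hz, rfl⟩
    rintro _ ⟨w, hw, rfl⟩
    exact hAinv u t ht w (interior_subset hw)
  have hUX : ∀ t : ℝ, 0 ≤ t → ∀ z ∈ interior A, flow X t z ∈ interior A := by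
    simpa using hU 0
  have hAL : ∀ v ∈ L, ∀ z, v + z ∈ interior A ↔ z ∈ interior A := by
    have aux : ∀ v ∈ L, ∀ z ∈ interior A, v + z ∈ interior A := by
      intro v hv z hz
      have ho := (Homeomorph.addLeft v).isOpenMap _ (isOpen_interior (s := A))
      refine interior_maximal ?_ ho ⟨z, hz, rfl⟩
      rintro _ ⟨w, hw, rfl⟩
      exact htrans _ _ _ (interior_subset hw) (hL v hv w)
    refine fun v hv z => ⟨fun h => ?_, aux v hv z⟩
    simpa using aux (-v) (L.neg_mem hv) _ h
  -- The closure is invariant in both directions: recurrence reverses the drift, and strong controls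
  -- of either sign give the control field.
  have hdense : closure (interior A) = univ := by
    have hfwd : ∀ u t : ℝ, 0 ≤ t → ∀ z ∈ closure (interior A),
        flow (X + u • Y) t z ∈ closure (interior A) := fun u t ht z hz =>
      map_mem_closure ((hXu u).continuous_flow_right t) hz (hU u t ht)
    refine eq_univ_of_flow_mem hX hY hgen isClosed_closure hA.closure (fun t z hz => ?_)
      (fun t z hz => ?_)
    · rcases le_total 0 t with ht | ht
      · simpa using hfwd 0 t ht z hz
      · have hsub := hrec _ isOpen_interior hAL (-t) (by linarith) (hUX (-t) (by linarith))
        have hback : ∀ w ∈ interior A, flow X t w ∈ closure (interior A) := by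
          intro w hw
          refine map_mem_closure (hX.continuous_flow_right t) (hsub hw) ?_
          rintro _ ⟨w', hw', rfl⟩
          rwa [hX.flow_flow_neg]
        have := map_mem_closure (hX.continuous_flow_right t) hz hback
        rwa [closure_closure] at this
    · rcases le_total 0 t with ht | ht
      · simpa using flow_smul_mem_of_isClosed hX hY isClosed_closure hfwd 1 ht hz
      · have := flow_smul_mem_of_isClosed hX hY isClosed_closure hfwd (-1) (neg_nonneg.2 ht) hz
        rw [hY.flow_const_smul] at this
        simpa using this
  obtain ⟨z, hzB, hzA⟩ := (dense_iff_closure_eq.2 hdense).inter_open_nonempty _ isOpen_interior hB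
  exact htrans _ _ _ (interior_subset hzA : z ∈ A) (interior_subset hzB : z ∈ B)

end Control

/-! ### Change of time along an integral curve -/

/-- An integral curve of a positive multiple `ρ Z` of `Z` is, after a change of the time parameter, an
integral curve of `Z`. -/
lemma exists_integralCurveOn_of_smul {E : Type*} [NormedAddCommGroup E] [NormedSpace ℝ E]
    {Z : E → E} {ρ : E → ℝ} (hρ : Continuous ρ) (hpos : ∀ x, 0 < ρ x) {γ : ℝ → E}
    (hγ : ∀ t, HasDerivAt γ (ρ (γ t) • Z (γ t)) t) {T : ℝ} (hT : 0 ≤ T) :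
    ∃ T' : ℝ, 0 ≤ T' ∧ ∃ η : ℝ → E, IsIntegralCurveOn η (fun _ => Z) (Icc 0 T') ∧
      η 0 = γ 0 ∧ η T' = γ T := by
  have hγc : Continuous γ := continuous_iff_continuousAt.2 fun t => (hγ t).continuousAt
  have hc : Continuous fun t => ρ (γ t) := hρ.comp hγc
  let τ : ℝ → ℝ := fun t => ∫ s in (0 : ℝ)..t, ρ (γ s)
  have hτ : ∀ t, HasStrictDerivAt τ (ρ (γ t)) t := fun t => hc.integral_hasStrictDerivAt 0 t
  have hmono : StrictMono τ := strictMono_of_deriv_pos fun t => by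
    rw [(hτ t).hasDerivAt.deriv]
    exact hpos _
  have hτ0 : τ 0 = 0 := by simp [τ]
  let σ := Function.invFun τ
  have hσ : ∀ t, σ (τ t) = t := Function.leftInverse_invFun hmono.injective
  refine ⟨τ T, hτ0 ▸ hmono.monotone hT, γ ∘ σ, fun s hs => ?_, ?_, ?_⟩
  · have hcont : ContinuousOn τ (Icc 0 T) := fun t _ =>
      (hτ t).hasDerivAt.continuousAt.continuousWithinAt
    obtain ⟨a, -, rfl⟩ := intermediate_value_Icc hT hcont (by rwa [hτ0])
    have h1 := ((hτ a).to_local_left_inverse (hpos _).ne' (Eventually.of_forall hσ)).hasDerivAt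
    have h2 : HasDerivAt γ (ρ (γ a) • Z (γ a)) (σ (τ a)) := by
      rw [hσ]
      exact hγ a
    have h3 := h2.scomp (τ a) h1
    rw [smul_smul, inv_mul_cancel₀ (hpos _).ne', one_smul] at h3
    simpa [hσ] using h3.hasDerivWithinAt
  · have := hσ 0
    rw [hτ0] at this
    simp [this]
  · simp [hσ]

/-! ### The pendulum -/

namespace Pendulum

open Asymptotics

/-- The positivity of the physical parameters. -/
structure Params.Pos (P : Params) : Prop where
  m₁ : 0 < P.m₁
  m₂ : 0 < P.m₂
  r₁ : 0 < P.r₁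
  r₂ : 0 < P.r₂
  g : 0 < P.g

/-- The energy of the uncontrolled double pendulum, with the constant normalized so that the potential
energy is at least `1`. -/
noncomputable def energy (P : Params) (z : Coord) : ℝ :=
  ((P.m₁ + P.m₂) * P.r₁ ^ 2 * z 2 ^ 2 + P.m₂ * P.r₂ ^ 2 * z 3 ^ 2
      + 2 * P.m₂ * P.r₁ * P.r₂ * (z 2 * z 3 * Real.cos (z 0 - z 1))) / 2
    + P.g * ((P.m₁ + P.m₂) * P.r₁ * (1 + Real.cos (z 0))
      + P.m₂ * P.r₂ * (1 + Real.cos (z 1))) + 1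

variable {P : Params}

lemma Δ_pos (hP : P.Pos) (z : Coord) : 0 < Δ P z := by
  have := hP.m₁; have := hP.m₂; have := hP.r₁; have := hP.r₂
  unfold Δ
  positivity

lemma X₁_eq (hP : P.Pos) (z : Coord) : X₁ P z = ![z 2 * Δ P z, z 3 * Δ P z,
    -P.g * P.r₂ * (P.m₂ * Real.sin (z 1) * Real.cos (z 0 - z 1) - (P.m₁ + P.m₂) * Real.sin (z 0))
      + Real.sin (z 0 - z 1) *
        (-P.m₂ * P.r₂ * (P.r₁ * Real.cos (z 0 - z 1) * z 2 ^ 2 + P.r₂ * z 3 ^ 2)),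
    -P.g * P.r₁ * (P.m₁ + P.m₂) * (Real.cos (z 0 - z 1) * Real.sin (z 0) - Real.sin (z 1))
      + Real.sin (z 0 - z 1) * (P.r₁ * (P.r₁ * (P.m₁ + P.m₂) * z 2 ^ 2
        + P.r₂ * P.m₂ * Real.cos (z 0 - z 1) * z 3 ^ 2))] := by
  have h := (Δ_pos hP z).ne'
  rw [X₁, f, smul_add, smul_smul, smul_smul, mul_one_div_cancel h, one_smul, mul_div_cancel₀ _ h]
  funext i
  fin_cases i <;> simp

lemma X₂_eq (hP : P.Pos) (z : Coord) : X₂ P z = ![0, 0,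
    P.m₂ * (P.r₂ * (P.r₁ * P.m₂ * Real.cos (z 0 - z 1) - P.r₂ * P.m₁)),
    P.m₂ * (P.r₁ * (P.r₂ * P.m₁ * Real.cos (z 0 - z 1) - P.r₁ * (P.m₁ + P.m₂)))] := by
  rw [X₂, h, smul_smul, mul_div_cancel₀ _ (Δ_pos hP z).ne']
  funext i
  fin_cases i <;> simp

lemma contDiff_X₁ (hP : P.Pos) : ContDiff ℝ ∞ (X₁ P) := by
  have : X₁ P = _ := funext (X₁_eq hP)
  rw [this, contDiff_pi]
  intro i
  fin_cases i <;> simp [Δ] <;> fun_prop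

lemma contDiff_X₂ (hP : P.Pos) : ContDiff ℝ ∞ (X₂ P) := by
  have : X₂ P = _ := funext (X₂_eq hP)
  rw [this, contDiff_pi]
  intro i
  fin_cases i <;> simp <;> fun_prop

lemma contDiff_energy : ContDiff ℝ ∞ (energy P) := by
  unfold energy
  fun_prop

/-- The energy controls the angular velocities because the kinetic energy is uniformly positive
definite. -/
lemma exists_le_energy (hP : P.Pos) :
    ∃ c : ℝ, 0 < c ∧ ∀ z : Coord, c * (1 + z 2 ^ 2 + z 3 ^ 2) ≤ energy P z := by
  obtain ⟨hm₁, hm₂, hr₁, hr₂, hg⟩ := hP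
  set e := min (P.m₁ / 4) (P.m₂ / 2) with he
  have he0 : 0 < e := lt_min (by positivity) (by positivity)
  have he1 : e ≤ P.m₁ / 4 := min_le_left _ _
  have he2 : e ≤ P.m₂ / 2 := min_le_right _ _
  set c := min 1 (min (e * P.r₁ ^ 2 / 2) (e * P.r₂ ^ 2 / 2)) with hc
  have hc1 : c ≤ 1 := min_le_left _ _
  have hc2 : c ≤ e * P.r₁ ^ 2 / 2 := (min_le_right _ _).trans (min_le_left _ _)
  have hc3 : c ≤ e * P.r₂ ^ 2 / 2 := (min_le_right _ _).trans (min_le_right _ _)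
  refine ⟨c, lt_min one_pos (lt_min (by positivity) (by positivity)), fun z => ?_⟩
  have hpot : 0 ≤ P.g * ((P.m₁ + P.m₂) * P.r₁ * (1 + Real.cos (z 0))
      + P.m₂ * P.r₂ * (1 + Real.cos (z 1))) := by
    have h0 : 0 ≤ 1 + Real.cos (z 0) := by linarith [Real.neg_one_le_cos (z 0)]
    have h1 : 0 ≤ 1 + Real.cos (z 1) := by linarith [Real.neg_one_le_cos (z 1)]
    positivity
  set k := Real.cos (z 0 - z 1)
  have hk : k ^ 2 ≤ 1 := Real.cos_sq_le_one _
  set a := P.r₁ * z 2 with ha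
  set b := P.r₂ * z 3 with hb
  -- The kinetic energy is a sum of squares; `b` is recovered from `b + k a` and `a`.
  have hkin : (P.m₁ + P.m₂) * P.r₁ ^ 2 * z 2 ^ 2 + P.m₂ * P.r₂ ^ 2 * z 3 ^ 2
      + 2 * P.m₂ * P.r₁ * P.r₂ * (z 2 * z 3 * k) =
      P.m₁ * a ^ 2 + P.m₂ * ((b + k * a) ^ 2 + (1 - k ^ 2) * a ^ 2) := by
    rw [ha, hb]
    ring
  have hka : 0 ≤ (1 - k ^ 2) * a ^ 2 := mul_nonneg (by linarith) (sq_nonneg _)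
  have hb2 : b ^ 2 ≤ 2 * (b + k * a) ^ 2 + 2 * a ^ 2 := by
    nlinarith [sq_nonneg (b + 2 * (k * a))]
  have hlow : e * (a ^ 2 + b ^ 2) ≤
      P.m₁ * a ^ 2 + P.m₂ * ((b + k * a) ^ 2 + (1 - k ^ 2) * a ^ 2) := by
    have h1 : e * b ^ 2 ≤ e * (2 * (b + k * a) ^ 2 + 2 * a ^ 2) := by gcongr
    have h2 : e * (b + k * a) ^ 2 ≤ P.m₂ / 2 * (b + k * a) ^ 2 := by gcongr
    have h3 : e * a ^ 2 ≤ P.m₁ / 4 * a ^ 2 := by gcongr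
    have h4 : 0 ≤ P.m₂ * ((1 - k ^ 2) * a ^ 2) := by positivity
    have h5 : 0 ≤ P.m₁ * a ^ 2 := by positivity
    linarith
  have h2 : c * z 2 ^ 2 ≤ e * P.r₁ ^ 2 / 2 * z 2 ^ 2 := by gcongr
  have h3 : c * z 3 ^ 2 ≤ e * P.r₂ ^ 2 / 2 * z 3 ^ 2 := by gcongr
  have h4 : e * (a ^ 2 + b ^ 2) = e * P.r₁ ^ 2 * z 2 ^ 2 + e * P.r₂ ^ 2 * z 3 ^ 2 := by
    rw [ha, hb]
    ring
  unfold energy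
  linarith

lemma energy_pos (hP : P.Pos) (z : Coord) : 0 < energy P z := by
  obtain ⟨c, hc, h⟩ := exists_le_energy hP
  exact lt_of_lt_of_le (by positivity) (h z)

/-- The fields `X₁`, `X₂` divided by the energy. They are bounded, and division by the first integral
`energy` keeps the drift divergence-free. -/
noncomputable def drift (P : Params) (z : Coord) : Coord := (energy P z)⁻¹ • X₁ P z

/-- See `Pendulum.drift`. -/
noncomputable def control (P : Params) (z : Coord) : Coord := (energy P z)⁻¹ • X₂ P z

lemma boundedSmooth_inv_energy_smul (hP : P.Pos) {X : Coord → Coord} (hX : ContDiff ℝ ∞ X)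
    (hb : ∀ i, (fun z => X z i) =O[⊤] fun z => 1 + z 2 ^ 2 + z 3 ^ 2) :
    BoundedSmooth fun z => (energy P z)⁻¹ • X z := by
  refine ⟨(contDiff_energy.inv fun z => (energy_pos hP z).ne').fun_smul hX, ?_⟩
  obtain ⟨c, hc, hE⟩ := exists_le_energy hP
  obtain ⟨C, hC0, hC⟩ := (isBigO_pi.2 hb).exists_nonneg
  rw [isBigOWith_top] at hC
  refine ⟨C / c, by positivity, fun z => ?_⟩
  have hQ : 0 < 1 + z 2 ^ 2 + z 3 ^ 2 := by positivity
  have h1 := hC z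
  rw [Real.norm_of_nonneg hQ.le] at h1
  rw [norm_smul, norm_inv, Real.norm_of_nonneg (energy_pos hP z).le, inv_mul_le_iff₀ (energy_pos hP z)]
  calc ‖X z‖ ≤ C * (1 + z 2 ^ 2 + z 3 ^ 2) := h1
    _ = C / c * (c * (1 + z 2 ^ 2 + z 3 ^ 2)) := by field_simp
    _ ≤ C / c * energy P z := by gcongr; exact hE z
    _ = energy P z * (C / c) := mul_comm _ _

lemma sin_isBigO (φ : Coord → ℝ) : (fun z => Real.sin (φ z)) =O[⊤] fun _ => (1 : ℝ) :=
  isBigO_top.2 ⟨1, fun z => by simpa using Real.abs_sin_le_one _⟩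

lemma cos_isBigO (φ : Coord → ℝ) : (fun z => Real.cos (φ z)) =O[⊤] fun _ => (1 : ℝ) :=
  isBigO_top.2 ⟨1, fun z => by simpa using Real.abs_cos_le_one _⟩

lemma one_isBigO : (fun _ : Coord => (1 : ℝ)) =O[⊤] fun z => 1 + z 2 ^ 2 + z 3 ^ 2 :=
  isBigO_top.2 ⟨1, fun z => by
    rw [norm_one, one_mul, Real.norm_of_nonneg (by positivity)]
    linarith [sq_nonneg (z 2), sq_nonneg (z 3)]⟩

lemma sq_isBigO {i : Fin 4} (hi : i = 2 ∨ i = 3) :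
    (fun z : Coord => z i ^ 2) =O[⊤] fun z => 1 + z 2 ^ 2 + z 3 ^ 2 :=
  isBigO_top.2 ⟨1, fun z => by
    rw [one_mul, Real.norm_of_nonneg (by positivity), Real.norm_of_nonneg (by positivity)]
    rcases hi with rfl | rfl <;> linarith [sq_nonneg (z 2), sq_nonneg (z 3)]⟩

lemma coord_isBigO {i : Fin 4} (hi : i = 2 ∨ i = 3) :
    (fun z : Coord => z i) =O[⊤] fun z => 1 + z 2 ^ 2 + z 3 ^ 2 :=
  isBigO_top.2 ⟨1, fun z => by
    rw [one_mul, Real.norm_of_nonneg (r := 1 + z 2 ^ 2 + z 3 ^ 2) (by positivity),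
      Real.norm_eq_abs, abs_le]
    rcases hi with rfl | rfl <;> constructor <;>
      nlinarith [sq_nonneg (z 2), sq_nonneg (z 3), sq_nonneg (z 2 + 1), sq_nonneg (z 2 - 1),
        sq_nonneg (z 3 + 1), sq_nonneg (z 3 - 1)]⟩

lemma Δ_isBigO : Δ P =O[⊤] fun _ => (1 : ℝ) := by
  have h1 : (fun z : Coord => P.m₁ + P.m₂ * Real.sin (z 0 - z 1) ^ 2) =O[⊤] fun _ => (1 : ℝ) :=
    (isBigO_const_const _ one_ne_zero _).add
      ((by simpa using (sin_isBigO fun z => z 0 - z 1).pow 2 :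
        (fun z : Coord => Real.sin (z 0 - z 1) ^ 2) =O[⊤] fun _ => (1 : ℝ)).const_mul_left _)
  exact h1.const_mul_left _

/-- A bounded function times a function of at most quadratic growth. -/
lemma isBigO_bounded_mul {φ ψ Q : Coord → ℝ} (hφ : φ =O[⊤] fun _ => (1 : ℝ)) (hψ : ψ =O[⊤] Q) :
    (fun z => φ z * ψ z) =O[⊤] Q := by
  simpa using hφ.mul hψ

lemma boundedSmooth_drift (hP : P.Pos) : BoundedSmooth (drift P) := by
  refine boundedSmooth_inv_energy_smul hP (contDiff_X₁ hP) fun i => ?_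
  have s := sin_isBigO (fun z => z 0 - z 1)
  have k := cos_isBigO (fun z => z 0 - z 1)
  have s0 := sin_isBigO (fun z => z 0)
  have s1 := sin_isBigO (fun z => z 1)
  have w2 := sq_isBigO (i := 2) (Or.inl rfl)
  have w3 := sq_isBigO (i := 3) (Or.inr rfl)
  simp only [X₁_eq hP]
  fin_cases i
  · simpa [mul_comm] using isBigO_bounded_mul Δ_isBigO (coord_isBigO (i := 2) (Or.inl rfl))
  · simpa [mul_comm] using isBigO_bounded_mul Δ_isBigO (coord_isBigO (i := 3) (Or.inr rfl))
  · refine IsBigO.add (IsBigO.const_mul_left (IsBigO.sub ?_ ?_) _) (isBigO_bounded_mul s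
      (IsBigO.const_mul_left (IsBigO.add ?_ ?_) _))
    · exact (isBigO_bounded_mul (s1.const_mul_left _) k).trans one_isBigO
    · exact (s0.const_mul_left _).trans one_isBigO
    · exact isBigO_bounded_mul (k.const_mul_left _) w2
    · exact w3.const_mul_left _
  · refine IsBigO.add (IsBigO.const_mul_left (IsBigO.sub ?_ ?_) _) (isBigO_bounded_mul s
      (IsBigO.const_mul_left (IsBigO.add ?_ ?_) _))
    · exact (isBigO_bounded_mul k s0).trans one_isBigO
    · exact s1.trans one_isBigO
    · exact w2.const_mul_left _
    · exact isBigO_bounded_mul (k.const_mul_left _) w3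

lemma boundedSmooth_control (hP : P.Pos) : BoundedSmooth (control P) := by
  refine boundedSmooth_inv_energy_smul hP (contDiff_X₂ hP) fun i => ?_
  have k := cos_isBigO (fun z => z 0 - z 1)
  have c : ∀ a : ℝ, (fun _ : Coord => a) =O[⊤] fun _ => (1 : ℝ) :=
    fun a => isBigO_const_const a one_ne_zero _
  refine IsBigO.trans ?_ one_isBigO
  simp only [X₂_eq hP]
  fin_cases i
  · exact c 0
  · exact c 0
  · exact (((k.const_mul_left _).sub (c _)).const_mul_left _).const_mul_left _
  · exact (((k.const_mul_left _).sub (c _)).const_mul_left _).const_mul_left _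

end Pendulum

namespace Pendulum

variable {P : Params}

/-! ### Conservation of energy and of volume -/

lemma hasDerivAt_energy_comp {γ : ℝ → Coord} {v : Coord} {t : ℝ} (hγ : HasDerivAt γ v t) :
    HasDerivAt (fun s => energy P (γ s))
      ((P.m₁ + P.m₂) * P.r₁ ^ 2 * (γ t 2 * v 2) + P.m₂ * P.r₂ ^ 2 * (γ t 3 * v 3)
        + P.m₂ * P.r₁ * P.r₂ * ((v 2 * γ t 3 + γ t 2 * v 3) * Real.cos (γ t 0 - γ t 1)
          - γ t 2 * γ t 3 * (Real.sin (γ t 0 - γ t 1) * (v 0 - v 1)))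
        - P.g * ((P.m₁ + P.m₂) * P.r₁ * (Real.sin (γ t 0) * v 0)
          + P.m₂ * P.r₂ * (Real.sin (γ t 1) * v 1))) t := by
  have c : ∀ i, HasDerivAt (fun s => γ s i) (v i) t := fun i => (hasDerivAt_pi.1 hγ) i
  have hkin := ((((c 2).fun_pow 2).const_mul ((P.m₁ + P.m₂) * P.r₁ ^ 2)).fun_add
    (((c 3).fun_pow 2).const_mul (P.m₂ * P.r₂ ^ 2))).fun_add
    ((((c 2).fun_mul (c 3)).fun_mul ((c 0).fun_sub (c 1)).cos).const_mul (2 * P.m₂ * P.r₁ * P.r₂))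
  have hpot := ((((c 0).cos.const_add 1).const_mul ((P.m₁ + P.m₂) * P.r₁)).fun_add
    (((c 1).cos.const_add 1).const_mul (P.m₂ * P.r₂))).const_mul P.g
  refine (((hkin.div_const 2).fun_add hpot).add_const 1).congr_deriv ?_
  simp only [Nat.cast_ofNat, Nat.add_one_sub_one, pow_one]
  ring

/-- The energy is constant along every curve whose velocity is proportional to `X₁`. -/
lemma hasDerivAt_energy_comp_zero (hP : P.Pos) {γ : ℝ → Coord} {c t : ℝ}
    (hγ : HasDerivAt γ (c • X₁ P (γ t)) t) : HasDerivAt (fun s => energy P (γ s)) 0 t := by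
  refine (hasDerivAt_energy_comp hγ).congr_deriv ?_
  rw [X₁_eq hP, Δ]
  have hsc := Real.sin_sq_add_cos_sq (γ t 0 - γ t 1)
  set s := Real.sin (γ t 0 - γ t 1)
  set k := Real.cos (γ t 0 - γ t 1)
  set s₀ := Real.sin (γ t 0)
  set s₁ := Real.sin (γ t 1)
  simp only [Pi.smul_apply, smul_eq_mul, Matrix.cons_val]
  have hk : k ^ 2 = 1 - s ^ 2 := by linarith
  ring_nf
  simp only [hk]
  ring

lemma hasDerivAt_add_smul_const (z v : Coord) : HasDerivAt (fun s : ℝ => z + s • v) v 0 := by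
  simpa using ((hasDerivAt_id (0 : ℝ)).smul_const v).const_add z

lemma fderiv_energy_X₁ (hP : P.Pos) (z : Coord) : fderiv ℝ (energy P) z (X₁ P z) = 0 := by
  have hline : HasDerivAt (fun s : ℝ => z + s • X₁ P z) (X₁ P z) 0 :=
    hasDerivAt_add_smul_const z _
  have h1 : HasDerivAt (fun s : ℝ => energy P (z + s • X₁ P z)) 0 0 :=
    hasDerivAt_energy_comp_zero hP (c := 1) (by simpa using hline)
  have h2 : HasDerivAt (fun s : ℝ => energy P (z + s • X₁ P z))
      (fderiv ℝ (energy P) z (X₁ P z)) 0 := by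
    refine HasFDerivAt.comp_hasDerivAt (f := fun s : ℝ => z + s • X₁ P z) (l := energy P) 0 ?_ hline
    simpa using ((contDiff_energy (P := P)).differentiable (by simp) z).hasFDerivAt
  exact h2.unique h1

/-- `X₁` is divergence-free. -/
lemma trace_fderiv_X₁ (hP : P.Pos) (z : Coord) :
    LinearMap.trace ℝ Coord (fderiv ℝ (X₁ P) z : Coord →L[ℝ] Coord) = 0 := by
  -- The diagonal entries of the derivative are partial derivatives.
  have partial_eq : ∀ (i : Fin 4) (d : ℝ),
      HasDerivAt (fun s => X₁ P (Function.update z i s) i) d (z i) →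
      fderiv ℝ (X₁ P) z (Pi.single i 1) i = d := by
    intro i d hd
    have h1 : HasDerivAt (fun s => X₁ P (Function.update z i s))
        (fderiv ℝ (X₁ P) z (Pi.single i 1)) (z i) := by
      refine HasFDerivAt.comp_hasDerivAt (f := Function.update z i) (l := X₁ P) (z i) ?_
        (hasDerivAt_update z i (z i))
      simpa using ((contDiff_X₁ hP).differentiable (by simp) z).hasFDerivAt
    exact ((hasDerivAt_pi.1 h1) i).unique hd
  set s := Real.sin (z 0 - z 1) with hs
  set k := Real.cos (z 0 - z 1) with hk
  have hΔ : ∀ {φ : ℝ → ℝ} {φ' t : ℝ}, HasDerivAt φ φ' t →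
      HasDerivAt (fun u => P.r₁ * P.r₂ * (P.m₁ + P.m₂ * Real.sin (φ u) ^ 2))
        (2 * (P.r₁ * P.r₂ * P.m₂ * (Real.sin (φ t) * Real.cos (φ t) * φ'))) t := by
    intro φ φ' t hφ
    refine (((hφ.sin.fun_pow 2).const_mul P.m₂).const_add P.m₁ |>.const_mul
      (P.r₁ * P.r₂)).congr_deriv ?_
    simp only [Nat.cast_ofNat, Nat.add_one_sub_one, pow_one]
    ring
  have d0 := partial_eq 0 (z 2 * (2 * (P.r₁ * P.r₂ * P.m₂ * (s * k * 1)))) (by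
    have := (hΔ ((hasDerivAt_id (z 0)).sub_const (z 1))).const_mul (z 2)
    simpa [X₁_eq hP, Δ] using this)
  have d1 := partial_eq 1 (z 3 * (2 * (P.r₁ * P.r₂ * P.m₂ * (s * k * -1)))) (by
    have := (hΔ ((hasDerivAt_id (z 1)).const_sub (z 0))).const_mul (z 3)
    simpa [X₁_eq hP, Δ] using this)
  have d2 := partial_eq 2 (s * (-P.m₂ * P.r₂ * (P.r₁ * k * (2 * z 2)))) (by
    have := (((((((hasDerivAt_id (z 2)).fun_pow 2).const_mul (P.r₁ * k)).add_const
      (P.r₂ * z 3 ^ 2)).const_mul (-P.m₂ * P.r₂)).const_mul s).const_add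
      (-P.g * P.r₂ * (P.m₂ * Real.sin (z 1) * k - (P.m₁ + P.m₂) * Real.sin (z 0))))
    simpa [X₁_eq hP] using this)
  have d3 := partial_eq 3 (s * (P.r₁ * (P.r₂ * P.m₂ * k * (2 * z 3)))) (by
    have := (((((((hasDerivAt_id (z 3)).fun_pow 2).const_mul (P.r₂ * P.m₂ * k)).const_add
      (P.r₁ * (P.m₁ + P.m₂) * z 2 ^ 2)).const_mul P.r₁).const_mul s).const_add
      (-P.g * P.r₁ * (P.m₁ + P.m₂) * (k * Real.sin (z 0) - Real.sin (z 1))))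
    simpa [X₁_eq hP] using this)
  rw [trace_eq_sum_apply_single, Fin.sum_univ_four, d0, d1, d2, d3]
  ring

/-- Dividing by the first integral `energy` preserves the vanishing of the divergence. -/
lemma trace_fderiv_drift (hP : P.Pos) (z : Coord) :
    LinearMap.trace ℝ Coord (fderiv ℝ (drift P) z : Coord →L[ℝ] Coord) = 0 := by
  have hE := (contDiff_energy (P := P)).differentiable (by simp) z
  have hinv : HasFDerivAt (fun z => (energy P z)⁻¹)
      (-(energy P z ^ 2)⁻¹ • fderiv ℝ (energy P) z) z :=
    (hasDerivAt_inv (energy_pos hP z).ne').comp_hasFDerivAt z hE.hasFDerivAt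
  have hX := ((contDiff_X₁ hP).differentiable (by simp) z).hasFDerivAt
  have hd : fderiv ℝ (drift P) z = _ := (hinv.fun_smul hX).fderiv
  have h1 := trace_fderiv_X₁ hP z
  have h2 := fderiv_energy_X₁ hP z
  rw [trace_eq_sum_apply_single] at h1
  have h3 : ∑ i, fderiv ℝ (energy P) z (Pi.single i 1) * X₁ P z i = 0 := by
    have e : X₁ P z = ∑ i, X₁ P z i • (Pi.single i 1 : Coord) := by
      simpa using pi_eq_sum_univ' (X₁ P z)
    rw [e, map_sum] at h2
    rw [← h2]
    exact Finset.sum_congr rfl fun i _ => by rw [map_smul, smul_eq_mul, mul_comm]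
  rw [trace_eq_sum_apply_single, hd]
  simp only [add_apply, smul_apply, ContinuousLinearMap.smulRight_apply, Pi.add_apply, Pi.smul_apply, smul_eq_mul,
    Finset.sum_add_distrib, ← Finset.mul_sum, mul_assoc]
  rw [h1, h3]
  simp

lemma energy_flow (hP : P.Pos) (t : ℝ) (z : Coord) : energy P (flow (drift P) t z) = energy P z := by
  have hX := boundedSmooth_drift hP
  have h : ∀ t, HasDerivAt (fun t => energy P (flow (drift P) t z)) 0 t := fun t =>
    hasDerivAt_energy_comp_zero hP (c := (energy P (flow (drift P) t z))⁻¹) (hX.hasDerivAt_flow t z)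
  have := is_const_of_deriv_eq_zero (fun t => (h t).differentiableAt) (fun t => (h t).deriv) t 0
  simpa [hX.flow_zero] using this

/-! ### The lattice of periods -/

/-- The group `(2πℤ)² × 0` of deck transformations of the covering `toState`. -/
noncomputable def periods : AddSubgroup Coord where
  carrier := Set.range fun n : ℤ × ℤ => ![n.1 * (2 * Real.pi), n.2 * (2 * Real.pi), 0, 0]
  zero_mem' := ⟨0, by ext i; fin_cases i <;> simp⟩
  add_mem' := by
    rintro _ _ ⟨m, rfl⟩ ⟨n, rfl⟩
    exact ⟨m + n, by ext i; fin_cases i <;> simp <;> ring⟩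
  neg_mem' := by
    rintro _ ⟨n, rfl⟩
    exact ⟨-n, by ext i; fin_cases i <;> simp⟩

lemma countable_periods : Countable periods :=
  (Set.countable_range fun n : ℤ × ℤ =>
    (![n.1 * (2 * Real.pi), n.2 * (2 * Real.pi), 0, 0] : Coord)).to_subtype

lemma toState_add_of_mem_periods {v : Coord} (hv : v ∈ periods) (z : Coord) :
    toState (v + z) = toState z := by
  obtain ⟨n, rfl⟩ := hv
  simp [toState, Real.Angle.coe_add]

lemma Δ_congr {z w : Coord} (hzw : toState z = toState w) : Δ P z = Δ P w := by
  simp only [toState, Prod.mk.injEq] at hzw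
  have hs : Real.sin (z 0 - z 1) = Real.sin (w 0 - w 1) := by
    rw [← Real.Angle.sin_coe, Real.Angle.coe_sub, hzw.1, hzw.2.1, ← Real.Angle.coe_sub,
      Real.Angle.sin_coe]
  simp only [Δ, hs]

lemma energy_congr {z w : Coord} (hzw : toState z = toState w) : energy P z = energy P w := by
  simp only [toState, Prod.mk.injEq] at hzw
  obtain ⟨h0, h1, h2, h3⟩ := hzw
  have hc0 : Real.cos (z 0) = Real.cos (w 0) := by
    rw [← Real.Angle.cos_coe, h0, Real.Angle.cos_coe]
  have hc1 : Real.cos (z 1) = Real.cos (w 1) := by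
    rw [← Real.Angle.cos_coe, h1, Real.Angle.cos_coe]
  have hc : Real.cos (z 0 - z 1) = Real.cos (w 0 - w 1) := by
    rw [← Real.Angle.cos_coe, Real.Angle.coe_sub, h0, h1, ← Real.Angle.coe_sub,
      Real.Angle.cos_coe]
  simp only [energy, hc0, hc1, hc, h2, h3]

lemma drift_congr {z w : Coord} (hzw : toState z = toState w) : drift P z = drift P w := by
  simp only [drift, X₁, energy_congr hzw, Δ_congr hzw, f_congr P hzw]

/-- The points whose angles are reduced to `[0, 2π)`. -/
def fundamentalStrip : Set Coord :=
  {z | z 0 ∈ Ico 0 (2 * Real.pi) ∧ z 1 ∈ Ico 0 (2 * Real.pi)}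

lemma measurableSet_fundamentalStrip : MeasurableSet fundamentalStrip :=
  (measurableSet_Ico.preimage (measurable_pi_apply 0)).inter
    (measurableSet_Ico.preimage (measurable_pi_apply 1))

lemma existsUnique_add_mem_fundamentalStrip (z : Coord) :
    ∃! v : periods, (v : Coord) + z ∈ fundamentalStrip := by
  have h2π : 0 < 2 * Real.pi := Real.two_pi_pos
  obtain ⟨a, ha, ha'⟩ := existsUnique_add_zsmul_mem_Ico h2π (z 0) 0
  obtain ⟨b, hb, hb'⟩ := existsUnique_add_zsmul_mem_Ico h2π (z 1) 0
  simp only [zsmul_eq_mul, zero_add] at ha ha' hb hb'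
  refine ⟨⟨_, (a, b), rfl⟩, ?_, ?_⟩
  · simp only [fundamentalStrip, mem_ofPred_eq, Pi.add_apply, Matrix.cons_val]
    rw [add_comm _ (z 0), add_comm _ (z 1)]
    exact ⟨ha, hb⟩
  · rintro ⟨_, ⟨m, n⟩, rfl⟩ h
    simp only [fundamentalStrip, mem_ofPred_eq, Pi.add_apply, Matrix.cons_val] at h
    have h1 := ha' m (by rw [add_comm]; exact h.1)
    have h2 := hb' n (by rw [add_comm]; exact h.2)
    subst h1 h2
    rfl

lemma measure_energy_lt_inter_ne_top (hP : P.Pos) (c : ℝ) :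
    MeasureTheory.volume ({z | energy P z < c} ∩ fundamentalStrip) ≠ ⊤ := by
  obtain ⟨e, he, hE⟩ := exists_le_energy hP
  refine (Bornology.IsBounded.measure_lt_top ?_).ne
  refine (isBounded_closedBall (x := (0 : Coord)) (r := max (2 * Real.pi) (c / e))).subset ?_
  rintro z ⟨hz, h0, h1⟩
  rw [mem_closedBall_zero_iff, pi_norm_le_iff_of_nonneg (le_max_of_le_left Real.two_pi_pos.le)]
  have hQ : 1 + z 2 ^ 2 + z 3 ^ 2 ≤ c / e := by
    rw [le_div_iff₀ he, mul_comm]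
    exact (hE z).trans (le_of_lt hz)
  intro i
  rw [Real.norm_eq_abs, abs_le]
  have hm1 : 2 * Real.pi ≤ max (2 * Real.pi) (c / e) := le_max_left _ _
  have hm2 : c / e ≤ max (2 * Real.pi) (c / e) := le_max_right _ _
  fin_cases i
  · constructor <;> simp only [Fin.zero_eta] <;> linarith [h0.1, h0.2, Real.pi_pos]
  · constructor <;> simp only [Fin.mk_one] <;> linarith [h1.1, h1.2, Real.pi_pos]
  · change -_ ≤ z 2 ∧ z 2 ≤ _
    constructor <;> nlinarith [sq_nonneg (z 3), sq_nonneg (z 2 + 1), sq_nonneg (z 2 - 1)]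
  · change -_ ≤ z 3 ∧ z 3 ≤ _
    constructor <;> nlinarith [sq_nonneg (z 2), sq_nonneg (z 3 + 1), sq_nonneg (z 3 - 1)]

/-! ### Controllability -/

/-- Motions along the rescaled fields are motions of the control system, up to the time parameter. -/
lemma step_flow (hP : P.Pos) (u : ℝ) {t : ℝ} (ht : 0 ≤ t) (z : Coord) :
    Step (systemFields P) (toState z) (toState (flow (drift P + u • control P) t z)) := by
  have hX : BoundedSmooth (drift P + u • control P) :=
    (boundedSmooth_drift hP).add ((boundedSmooth_control hP).const_smul u)
  have hρ : Continuous fun z => Δ P z / energy P z := by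
    refine Continuous.div ?_ contDiff_energy.continuous fun z => (energy_pos hP z).ne'
    unfold Δ
    fun_prop
  have e : ∀ w, (drift P + u • control P) w = (Δ P w / energy P w) • (f P w + u • h P w) := by
    intro w
    simp only [Pi.add_apply, Pi.smul_apply, drift, control, X₁, X₂, smul_smul, smul_add]
    congr 2 <;> ring
  obtain ⟨T, hT, η, hη, h0, h1⟩ := exists_integralCurveOn_of_smul
    (Z := fun w => f P w + u • h P w) hρ (fun w => div_pos (Δ_pos hP w) (energy_pos hP w))
    (γ := fun t => flow (drift P + u • control P) t z)
    (fun t => by rw [← e]; exact hX.hasDerivAt_flow t z) ht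
  refine ⟨_, ⟨u, rfl⟩, T, hT, η, hη, ?_, ?_⟩
  · rw [h0, hX.flow_zero]
  · rw [h1]

lemma exists_inLieModule_apply_eq (hP : P.Pos) (hBG : BracketGenerating (family P)) (p v : Coord) :
    ∃ Z, InLieModule ![drift P, control P] Z ∧ Z p = v := by
  have hsm : ∀ i, ContDiff ℝ ∞ (![drift P, control P] i) := by
    intro i
    fin_cases i
    exacts [(boundedSmooth_drift hP).contDiff, (boundedSmooth_control hP).contDiff]
  have hE := fun z => (energy_pos hP z).ne'
  have h₁ : InLieModule ![drift P, control P] (X₁ P) := by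
    convert! (InLieModule.of (X := ![drift P, control P]) 0).smul (contDiff_energy (P := P)) using 1
    funext z
    simp [drift, smul_smul, hE z]
  have h₂ : InLieModule ![drift P, control P] (X₂ P) := by
    convert! (InLieModule.of (X := ![drift P, control P]) 1).smul (contDiff_energy (P := P)) using 1
    funext z
    simp [control, smul_smul, hE z]
  have h₃ : InLieModule ![drift P, control P] (X₃ P) := h₁.lieBracket hsm h₂
  have h₄ : InLieModule ![drift P, control P] (X₄ P) := h₂.lieBracket hsm h₃
  refine InLieModule.exists_apply_eq hsm ?_ ⟨_, Or.inl rfl⟩ hBG p v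
  rintro Y (rfl | rfl | rfl | rfl)
  exacts [h₁, h₂, h₃, h₄]

lemma toState_surjective : Function.Surjective toState := by
  rintro ⟨a, b, c, d⟩
  obtain ⟨x, rfl⟩ := QuotientAddGroup.mk_surjective a
  obtain ⟨y, rfl⟩ := QuotientAddGroup.mk_surjective b
  exact ⟨![x, y, c, d], rfl⟩

lemma controllable (hP : P.Pos) (hBG : BracketGenerating (family P)) : Controllable P := by
  intro p
  rw [eq_univ_iff_forall]
  intro q
  obtain ⟨x, rfl⟩ := toState_surjective p
  obtain ⟨y, rfl⟩ := toState_surjective q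
  have : Countable periods := countable_periods
  refine reachable_of_recurrent_drift (boundedSmooth_drift hP) (boundedSmooth_control hP)
    (exists_inLieModule_apply_eq hP hBG) (L := periods)
    (R := fun x y => Relation.ReflTransGen (Step (systemFields P)) (toState x) (toState y))
    (fun _ => .refl) (fun _ _ _ => .trans) (fun v hv z => ?_)
    (fun u t ht z => .single (step_flow hP u ht z)) (fun U hU hUL t _ hUt => ?_) x y
  · rw [toState_add_of_mem_periods hv]
  · exact (boundedSmooth_drift hP).subset_closure_image_flow (trace_fderiv_drift hP)
      MeasureTheory.volume (fun v hv z => drift_congr (toState_add_of_mem_periods hv z))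
      contDiff_energy.continuous (energy_flow hP)
      (fun v hv z => energy_congr (toState_add_of_mem_periods hv z))
      measurableSet_fundamentalStrip existsUnique_add_mem_fundamentalStrip
      (measure_energy_lt_inter_ne_top hP) hU hUL hUt

end Pendulum

theorem mainTheorem1 (P : Pendulum.Params)
    (hm₁ : 0 < P.m₁) (hm₂ : 0 < P.m₂) (hr₁ : 0 < P.r₁) (hr₂ : 0 < P.r₂) (hg : 0 < P.g)
    (hplus : P.m₁ / P.m₂ ≠
      P.r₁ * (P.r₁ + P.r₂) / (P.r₂ ^ 2 - P.r₁ * (P.r₁ + P.r₂)))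
    (hminus : P.m₁ / P.m₂ ≠
      P.r₁ * (P.r₁ - P.r₂) / (P.r₂ ^ 2 - P.r₁ * (P.r₁ - P.r₂)))
    (hthird : P.m₁ / P.m₂ ≠ (P.r₂ ^ 2 - P.r₁ ^ 2) / P.r₁ ^ 2)
    (hBG : BracketGenerating (Pendulum.family P)) :
    Pendulum.Controllable P :=
  Pendulum.controllable ⟨hm₁, hm₂, hr₁, hr₂, hg⟩ hBG
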